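/- \textbf{Theorem (approximate critical points in finite time).} Let $\mathcal G:\mathbb R^{d_u}\to\mathbb R^{d_y}$, $y\in\mathbb R^{d_y}$, and let $\Gamma\in\mathbb R^{d_y\times d_y}$, $\Sigma\in\mathbb R^{d_u\times d_u}$ be symmetric positive definite. Put $\|v\|_A^2=v^TA^{-1}v$ and $$\ell(u)=\|\mathcal G(u)-y\|_\Gamma^2+\|u\|_\Sigma^2,\qquad \mathcal H(u)=\begin{bmatrix}\mathcal G(u)\\ u\end{bmatrix},\quad z=\begin{bmatrix}y\\0\end{bmatrix},\quad \Gamma_+=\begin{bmatrix}\Gamma&0\\0&\Sigma\end{bmatrix}.$$ Assume that $\mathcal H$ is twice differentiable with bounded first and second derivatives: there are constants $M_1,M_2$ with $\|\nabla\mathcal H(x)\|\le M_1$ and $\|\nabla^2\mathcal H(x)[v,v]\|\le M_2\|v\|^2$ for all $x,v\in\mathbb R^{d_u}$. For an ensemble $u_n^{(1)},\dots,u_n^{(K)}\in\mathbb R^{d_u}$ write $m_n=\frac1K\sum_i u_n^{(i)}$, $\overline{\mathcal H}_n=\frac1K\sum_i\mathcal H(u_n^{(i)})$ and $$C_n^{uu}=\tfrac1K\sum_i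 (u_n^{(i)}-m_n)\otimes(u_n^{(i)}-m_n),\quad C_n^{pp}=\tfrac1K\sum_i(\mathcal H(u_n^{(i)})-\overline{\mathcal H}_n)\otimes(\mathcal H(u_n^{(i)})-\overline{\mathcal H}_n),$$ $$C_n^{pu}=\tfrac1K\sum_i(\mathcal H(u_n^{(i)})-\overline{\mathcal H}_n)\otimes(u_n^{(i)}-m_n),\quad C_n^{up}=(C_n^{pu})^T.$$ Let $(u_n^{(i)})_{n\ge 0}$ be any sequence of ensembles (ensemble Kalman inversion, EKI) satisfying, for all $n\ge0$, $$m_{n+1}=m_n+C_n^{up}(C_n^{pp}+h_n^{-1}\Gamma_+)^{-1}(z-\mathcal H(m_n)),$$ $$C_{n+1}^{uu}=C_n^{uu}-C_n^{up}(C_n^{pp}+h_n^{-1}\Gamma_+)^{-1}C_n^{pu}+\alpha_n^2\Sigma,$$ where $h_0>0$ and $\alpha_0>0$ are given and, for $n\ge1$, $h_n=h_0n^\beta$ and $\alpha_n^2=\alpha_0^2h_0^{-1}n^{2\gamma-\beta-2}$. Assume $$0\le\gamma<1,\qquad \gamma-1<\beta\le\gamma,$$ and that the sequence $(m_n)_{n\ge0}$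 is bounded. Let $0\le\delta<\beta+1-\gamma$. Then there is a constant $D>0$, independent of $\epsilon$, such that for every $\epsilon>0$ $$\min_{0\le n\le N_\epsilon}\|\nabla\ell(m_n)\|\le\epsilon,\qquad N_\epsilon=\begin{cases}\exp(D/\epsilon^2)&\text{if }\gamma=0,\\ (D/\epsilon^2)^{2/\min\{2\gamma,\ \beta+1-\gamma+\delta\}}&\text{if }0<\gamma<1.\end{cases}$$ -/

import Mathlib

open scoped Matrix

noncomputable section

namespace EKI

/-- The Euclidean space `ℝ^d`. -/
abbrev Vec (d : ℕ) : Type := EuclideanSpace ℝ (Fin d)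

/-- The observation space `ℝ^{dy} × ℝ^{du} = ℝ^{dy+du}` of the regularized problem, with its
Euclidean norm. -/
abbrev ObsVec (dy du : ℕ) : Type := EuclideanSpace ℝ (Fin dy ⊕ Fin du)

/-- The squared Mahalanobis norm `‖v‖²_A = vᵀ A⁻¹ v`. -/
def mahalanobisSq {ι : Type} [Fintype ι] [DecidableEq ι] (A : Matrix ι ι ℝ)
    (v : EuclideanSpace ℝ ι) : ℝ :=
  v.ofLp ⬝ᵥ (A⁻¹ *ᵥ v.ofLp)

/-- The Tikhonov-regularized loss `ℓ(u) = ‖G(u) - y‖²_Γ + ‖u‖²_S`. -/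
def loss {du dy : ℕ} (G : Vec du → Vec dy) (y : Vec dy)
    (Γ : Matrix (Fin dy) (Fin dy) ℝ) (S : Matrix (Fin du) (Fin du) ℝ) (u : Vec du) : ℝ :=
  mahalanobisSq Γ (G u - y) + mahalanobisSq S u

/-- The augmented forward map `H(u) = (G(u), u)`. -/
def augMap {du dy : ℕ} (G : Vec du → Vec dy) (u : Vec du) : ObsVec dy du :=
  WithLp.toLp 2 (Sum.elim (G u).ofLp u.ofLp)

/-- The augmented data `z = (y, 0)`. -/
def augData {dy : ℕ} (du : ℕ) (y : Vec dy) : ObsVec dy du :=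
  WithLp.toLp 2 (Sum.elim y.ofLp 0)

/-- The augmented noise covariance `Γ₊ = diag(Γ, S)`. -/
def augCov {du dy : ℕ} (Γ : Matrix (Fin dy) (Fin dy) ℝ) (S : Matrix (Fin du) (Fin du) ℝ) :
    Matrix (Fin dy ⊕ Fin du) (Fin dy ⊕ Fin du) ℝ :=
  Matrix.fromBlocks Γ 0 0 S

/-- The map `H` is twice differentiable with bounded first and second derivatives. -/
def HasBoundedDerivs {E F : Type} [NormedAddCommGroup E] [NormedSpace ℝ E]
    [NormedAddCommGroup F] [NormedSpace ℝ F] (H : E → F) : Prop :=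
  Differentiable ℝ H ∧ Differentiable ℝ (fderiv ℝ H) ∧
    ∃ M₁ M₂ : ℝ, (∀ x, ‖fderiv ℝ H x‖ ≤ M₁) ∧
      ∀ x v, ‖fderiv ℝ (fderiv ℝ H) x v v‖ ≤ M₂ * ‖v‖ ^ 2

/-- The mean `(1/K) ∑ᵢ xᵢ` of an ensemble. -/
def ensMean {ι : Type} {K : ℕ} (x : Fin K → EuclideanSpace ℝ ι) : EuclideanSpace ℝ ι :=
  (K : ℝ)⁻¹ • ∑ i, x i

/-- The sample cross covariance `(1/K) ∑ᵢ (xᵢ - x̄) ⊗ (wᵢ - w̄)` of two ensembles. -/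
def ensCov {ι κ : Type} {K : ℕ} (x : Fin K → EuclideanSpace ℝ ι)
    (w : Fin K → EuclideanSpace ℝ κ) : Matrix ι κ ℝ :=
  (K : ℝ)⁻¹ • ∑ i, Matrix.vecMulVec (x i - ensMean x).ofLp (w i - ensMean w).ofLp

/-- The Kalman gain `C^{up} (C^{pp} + h⁻¹ Γ₊)⁻¹` of the ensemble `u` for the step-size `h`. -/
def gain {du dy K : ℕ} (G : Vec du → Vec dy)
    (Γ : Matrix (Fin dy) (Fin dy) ℝ) (S : Matrix (Fin du) (Fin du) ℝ) (h : ℝ)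
    (u : Fin K → Vec du) : Matrix (Fin du) (Fin dy ⊕ Fin du) ℝ :=
  ensCov u (fun i => augMap G (u i)) *
    (ensCov (fun i => augMap G (u i)) (fun i => augMap G (u i)) + h⁻¹ • augCov Γ S)⁻¹

/-- The sequence of ensembles `u n` is a run of (Tikhonov) ensemble Kalman inversion with
step-sizes `h n` and squared inflation factors `αsq n`: the ensemble means and the ensemble
covariances satisfy the mean and covariance update formulas. How an ensemble with the prescribed
mean and covariance is produced is left free. -/
structure IsRun {du dy K : ℕ} (G : Vec du → Vec dy) (y : Vec dy)
    (Γ : Matrix (Fin dy) (Fin dy) ℝ) (S : Matrix (Fin du) (Fin du) ℝ)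
    (h αsq : ℕ → ℝ) (u : ℕ → Fin K → Vec du) : Prop where
  mean_update : ∀ n, ensMean (u (n + 1)) = ensMean (u n) +
    WithLp.toLp 2 (gain G Γ S (h n) (u n) *ᵥ (augData du y - augMap G (ensMean (u n))).ofLp)
  cov_update : ∀ n, ensCov (u (n + 1)) (u (n + 1)) = ensCov (u n) (u n) -
    gain G Γ S (h n) (u n) * ensCov (fun i => augMap G (u n i)) (u n) + αsq n • S

/-- The step-sizes: `h_n = h₀ n^β` for `n ≥ 1`, and `h₀` itself at `n = 0`. -/
def stepSize (h₀ β : ℝ) (n : ℕ) : ℝ :=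
  if n = 0 then h₀ else h₀ * (n : ℝ) ^ β

/-- The squared inflation factors: `α_n² = α₀² h₀⁻¹ n^(2γ-β-2)` for `n ≥ 1`, and `α₀²` itself
at `n = 0`. -/
def inflationSq (α₀ h₀ β γ : ℝ) (n : ℕ) : ℝ :=
  if n = 0 then α₀ ^ 2 else α₀ ^ 2 * h₀⁻¹ * (n : ℝ) ^ (2 * γ - β - 2)

/-- The iteration threshold: `exp(D/ε²)` if `γ = 0`, and
`(D/ε²)^(2 / min{2γ, β+1-γ+δ})` otherwise. -/
def threshold (β γ δ D ε : ℝ) : ℝ :=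
  if γ = 0 then Real.exp (D / ε ^ 2)
  else (D / ε ^ 2) ^ (2 / min (2 * γ) (β + 1 - γ + δ))

end EKI

end

/-!
In ensemble coordinates one step of ensemble Kalman inversion is an exact preconditioned gradient
step for the loss `ℓ`, up to linearization errors. Let `X` and `Y` be the matrices of scaled
deviations of the ensemble and of its image under `H`, so that `C^{uu} = X Xᵀ`, `C^{up} = X Yᵀ` and
`C^{pp} = Y Yᵀ`, let `Λ = Γ₊⁻¹` and let `W = (I + h Yᵀ Λ Y)⁻¹`, a matrix indexed by the ensemble
members. The push-through identity `transpose_mul_inv_eq` gives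

* the covariance update `C_{n+1} = X W Xᵀ + α² S` (`cov_sub_gain_eq`);
* the mean update `m_{n+1} - m_n = -h X W (Xᵀ ∇ℓ(m_n) / 2 + Rᵀ Λ (H(m_n) - z))`
  (`gain_mulVec_eq`), where `R = Y - DH(m_n) X` is the matrix of linearization errors, whose norm is
  of the order of the variance of the ensemble (`ensVar_remainder_le`).

Put `p = β + 1 - γ ∈ (0, 1]`. As the unknown is part of the observation, `Yᵀ Λ Y ≥ Xᵀ S⁻¹ X`, so
`C_n ≤ c S` implies `C_{n+1} ≤ ((c⁻¹ + h)⁻¹ + α²) S`; as `H` is Lipschitz, `W` is bounded below by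
`(1 + const · h tr C_n)⁻¹`. Since `α_n²` is of the order `n^{γ-1-p}`, these two recursions show that
`C_n` lies between two multiples of `n^{-p} S` for `n ≥ 1` (`exists_cov_le`, `exists_le_cov`).

The quadratic upper bound for `ℓ` (`loss_add_le`) and Young's inequality for the form `W` then give
`κ n^{γ-1} ‖∇ℓ(m_n)‖² ≤ ℓ(m_n) - ℓ(m_{n+1}) + B n^{γ-1-p}` for all large `n` (`loss_step_le`).
The main point is that the preconditioner `X W Xᵀ` is treated exactly: its deviation from `C^{uu}`,
which is of relative order `n^{γ-1}`, would be too large an error when `γ` is near `1`.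

Summing over `n ≤ N`, the weights on the left add up to at least `N^γ`, or `log N` for `γ = 0`. The
errors are `O(N^{γ-θ})` whenever `θ ≤ γ` and `θ < p` (`exists_sum_bound`), and the exponent
`θ = min(γ, (p + δ) / 2)` of the threshold is of this kind because `δ < p`
(`exists_le_threshold`).
-/

namespace EKI

set_option linter.unusedSectionVars false

/-! ### Quadratic forms of positive definite matrices -/

section QuadraticForms

variable {ι κ ο : Type} [Fintype ι] [DecidableEq ι] [Fintype κ] [DecidableEq κ]
  [Fintype ο] [DecidableEq ο]

theorem dotProduct_mulVec_comm {M : Matrix ι ι ℝ} (hM : M.IsHermitian) (v w : ι → ℝ) :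
    v ⬝ᵥ (M *ᵥ w) = w ⬝ᵥ (M *ᵥ v) := by
  have hT : Mᵀ = M := by simpa [Matrix.IsHermitian] using hM
  rw [Matrix.dotProduct_mulVec, ← Matrix.mulVec_transpose, hT, dotProduct_comm]

theorem dotProduct_mulVec_nonneg {M : Matrix ι ι ℝ} (hM : M.PosSemidef) (v : ι → ℝ) :
    0 ≤ v ⬝ᵥ (M *ᵥ v) := by
  simpa using hM.dotProduct_mulVec_nonneg v

theorem mulVec_inv_mulVec {M : Matrix ι ι ℝ} (hM : M.PosDef) (v : ι → ℝ) :
    M *ᵥ (M⁻¹ *ᵥ v) = v := by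
  rw [Matrix.mulVec_mulVec, Matrix.mul_nonsing_inv _ ((Matrix.isUnit_iff_isUnit_det _).1 hM.isUnit),
    Matrix.one_mulVec]

/-- The variational inequality (Fenchel–Young) for the quadratic form of `M⁻¹`; equality holds at
`x = M⁻¹ v`. -/
theorem two_mul_dotProduct_sub_le {M : Matrix ι ι ℝ} (hM : M.PosDef) (v x : ι → ℝ) :
    2 * (v ⬝ᵥ x) - x ⬝ᵥ (M *ᵥ x) ≤ v ⬝ᵥ (M⁻¹ *ᵥ v) := by
  have h := dotProduct_mulVec_nonneg hM.posSemidef (x - M⁻¹ *ᵥ v)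
  have hc := dotProduct_mulVec_comm hM.1 (M⁻¹ *ᵥ v) x
  rw [mulVec_inv_mulVec hM] at *
  rw [Matrix.mulVec_sub, mulVec_inv_mulVec hM, sub_dotProduct, dotProduct_sub, dotProduct_sub, hc,
    dotProduct_comm x v, dotProduct_comm _ v] at h
  linarith

theorem two_mul_dotProduct_le {M : Matrix ι ι ℝ} (hM : M.PosSemidef) (v w : ι → ℝ) :
    2 * (v ⬝ᵥ (M *ᵥ w)) ≤ v ⬝ᵥ (M *ᵥ v) + w ⬝ᵥ (M *ᵥ w) := by
  have h := dotProduct_mulVec_nonneg hM (v - w)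
  rw [Matrix.mulVec_sub, sub_dotProduct, dotProduct_sub, dotProduct_sub,
    dotProduct_mulVec_comm hM.1 w v] at h
  linarith

theorem exists_norm_mulVec_le (A : Matrix ι ι ℝ) :
    ∃ b : ℝ, 0 < b ∧ ∀ v : EuclideanSpace ℝ ι, ‖WithLp.toLp 2 (A *ᵥ v.ofLp)‖ ≤ b * ‖v‖ := by
  refine ⟨‖Matrix.toEuclideanCLM (𝕜 := ℝ) A‖ + 1, by positivity, fun v => ?_⟩
  have h := (Matrix.toEuclideanCLM (𝕜 := ℝ) A).le_opNorm v
  have h2 : Matrix.toEuclideanCLM (𝕜 := ℝ) A v = WithLp.toLp 2 (A *ᵥ v.ofLp) := rfl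
  rw [h2] at h
  nlinarith [norm_nonneg v]

theorem dotProduct_self_eq_norm_sq (v : ι → ℝ) : v ⬝ᵥ v = ‖WithLp.toLp 2 v‖ ^ 2 := by
  rw [EuclideanSpace.real_norm_sq_eq]
  simp [dotProduct, sq]

theorem dotProduct_eq_inner (v w : ι → ℝ) :
    v ⬝ᵥ w = inner ℝ (WithLp.toLp 2 v) (WithLp.toLp 2 w) := by
  rw [EuclideanSpace.inner_eq_star_dotProduct]
  simp [dotProduct_comm]

theorem exists_dotProduct_mulVec_le (A : Matrix ι ι ℝ) :
    ∃ b : ℝ, 0 < b ∧ ∀ v : ι → ℝ, v ⬝ᵥ (A *ᵥ v) ≤ b * (v ⬝ᵥ v) := by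
  obtain ⟨b, hb, h⟩ := exists_norm_mulVec_le A
  refine ⟨b, hb, fun v => ?_⟩
  rw [dotProduct_self_eq_norm_sq, dotProduct_eq_inner]
  have h1 := real_inner_le_norm (WithLp.toLp 2 v) (WithLp.toLp 2 (A *ᵥ v))
  have h2 := h (WithLp.toLp 2 v)
  nlinarith [norm_nonneg (WithLp.toLp 2 v)]

/-- A positive definite matrix is bounded below by a multiple of the identity. The constant is the
reciprocal of an upper bound for the inverse matrix. -/
theorem exists_le_dotProduct_mulVec {M : Matrix ι ι ℝ} (hM : M.PosDef) :
    ∃ s : ℝ, 0 < s ∧ ∀ v : ι → ℝ, s * (v ⬝ᵥ v) ≤ v ⬝ᵥ (M *ᵥ v) := by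
  obtain ⟨b, hb, h⟩ := exists_dotProduct_mulVec_le M⁻¹
  refine ⟨b⁻¹, inv_pos.2 hb, fun v => ?_⟩
  have h1 := two_mul_dotProduct_sub_le hM.inv v (b⁻¹ • v)
  have h2 := h v
  rw [Matrix.nonsing_inv_nonsing_inv _ ((Matrix.isUnit_iff_isUnit_det _).1 hM.isUnit),
    Matrix.mulVec_smul, dotProduct_smul, dotProduct_smul, smul_dotProduct] at h1
  simp only [smul_eq_mul] at h1
  have h3 : b⁻¹ * (b⁻¹ * (v ⬝ᵥ (M⁻¹ *ᵥ v))) ≤ b⁻¹ * (b⁻¹ * (b * (v ⬝ᵥ v))) := by gcongr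
  have h4 : b⁻¹ * (b⁻¹ * (b * (v ⬝ᵥ v))) = b⁻¹ * (v ⬝ᵥ v) := by field_simp
  linarith

end QuadraticForms

/-! ### The Kalman update in ensemble coordinates -/

section Weight

variable {ι κ ο : Type} [Fintype ι] [DecidableEq ι] [Fintype κ] [DecidableEq κ]
  [Fintype ο] [DecidableEq ο]

/-- The matrix `(I + h Yᵀ Γ⁻¹ Y)⁻¹` on the index set of the ensemble. Here `Y` has the scaled
deviations of the predictions as columns. -/
noncomputable def weight (Γ : Matrix ο ο ℝ) (h : ℝ) (Y : Matrix ο κ ℝ) : Matrix κ κ ℝ :=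
  (1 + h • (Yᵀ * Γ⁻¹ * Y))⁻¹

variable {Γ : Matrix ο ο ℝ} {h : ℝ} {Y : Matrix ο κ ℝ}

theorem posSemidef_conj_inv (hΓ : Γ.PosDef) (Y : Matrix ο κ ℝ) : (Yᵀ * Γ⁻¹ * Y).PosSemidef := by
  simpa using hΓ.inv.posSemidef.conjTranspose_mul_mul_same Y

theorem posDef_one_add (hΓ : Γ.PosDef) (hh : 0 < h) (Y : Matrix ο κ ℝ) :
    (1 + h • (Yᵀ * Γ⁻¹ * Y)).PosDef :=
  Matrix.PosDef.one.add_posSemidef ((posSemidef_conj_inv hΓ Y).smul hh.le)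

theorem weight_posDef (hΓ : Γ.PosDef) (hh : 0 < h) (Y : Matrix ο κ ℝ) :
    (weight Γ h Y).PosDef :=
  (posDef_one_add hΓ hh Y).inv

/-- The push-through identity `Yᵀ (Y Yᵀ + h⁻¹ Γ)⁻¹ = h (I + h Yᵀ Γ⁻¹ Y)⁻¹ Yᵀ Γ⁻¹`. -/
theorem transpose_mul_inv_eq (hΓ : Γ.PosDef) (hh : 0 < h) (Y : Matrix ο κ ℝ) :
    Yᵀ * (Y * Yᵀ + h⁻¹ • Γ)⁻¹ = h • (weight Γ h Y * Yᵀ * Γ⁻¹) := by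
  have hM := (Matrix.isUnit_iff_isUnit_det _).1 (posDef_one_add hΓ hh Y).isUnit
  have hΓu := (Matrix.isUnit_iff_isUnit_det _).1 hΓ.isUnit
  have hN : (Y * Yᵀ + h⁻¹ • Γ).PosDef := by
    refine Matrix.PosDef.posSemidef_add ?_ (hΓ.smul (inv_pos.2 hh))
    simpa using Matrix.posSemidef_self_mul_conjTranspose Y
  have hNu := (Matrix.isUnit_iff_isUnit_det _).1 hN.isUnit
  have key : (1 + h • (Yᵀ * Γ⁻¹ * Y)) * Yᵀ = h • (Yᵀ * Γ⁻¹) * (Y * Yᵀ + h⁻¹ • Γ) := by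
    rw [Matrix.add_mul, Matrix.mul_add, Matrix.one_mul, Matrix.mul_smul, Matrix.smul_mul, Matrix.smul_mul,
      Matrix.smul_mul, Matrix.mul_assoc Yᵀ Γ⁻¹ Γ, Matrix.nonsing_inv_mul _ hΓu, Matrix.mul_one,
      smul_smul, inv_mul_cancel₀ hh.ne', one_smul, add_comm]
    simp only [Matrix.mul_assoc]
  have h1 : Yᵀ = weight Γ h Y * (h • (Yᵀ * Γ⁻¹) * (Y * Yᵀ + h⁻¹ • Γ)) := by
    rw [← key, ← Matrix.mul_assoc, weight, Matrix.nonsing_inv_mul _ hM, Matrix.one_mul]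
  calc Yᵀ * (Y * Yᵀ + h⁻¹ • Γ)⁻¹
      = weight Γ h Y * (h • (Yᵀ * Γ⁻¹) * (Y * Yᵀ + h⁻¹ • Γ)) * (Y * Yᵀ + h⁻¹ • Γ)⁻¹ := by
        rw [← h1]
    _ = weight Γ h Y * (h • (Yᵀ * Γ⁻¹)) := by
        rw [Matrix.mul_assoc, Matrix.mul_assoc, Matrix.mul_nonsing_inv _ hNu, Matrix.mul_one]
    _ = _ := by rw [Matrix.mul_smul, Matrix.mul_assoc]

theorem one_sub_weight_mul (hΓ : Γ.PosDef) (hh : 0 < h) (Y : Matrix ο κ ℝ) :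
    1 - h • (weight Γ h Y * Yᵀ * Γ⁻¹) * Y = weight Γ h Y := by
  have hM := (Matrix.isUnit_iff_isUnit_det _).1 (posDef_one_add hΓ hh Y).isUnit
  have h1 : weight Γ h Y * (1 + h • (Yᵀ * Γ⁻¹ * Y)) = 1 := Matrix.nonsing_inv_mul _ hM
  rw [Matrix.mul_add, Matrix.mul_one, Matrix.mul_smul] at h1
  rw [sub_eq_iff_eq_add, ← h1, Matrix.smul_mul]
  simp only [Matrix.mul_assoc]

/-- The covariance update without inflation is `X W Xᵀ`, where `W` is the weight matrix. -/
theorem cov_sub_gain_mul (hΓ : Γ.PosDef) (hh : 0 < h) (X : Matrix ι κ ℝ) (Y : Matrix ο κ ℝ) :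
    X * Xᵀ - X * Yᵀ * (Y * Yᵀ + h⁻¹ • Γ)⁻¹ * (Y * Xᵀ) = X * weight Γ h Y * Xᵀ := by
  rw [Matrix.mul_assoc X, transpose_mul_inv_eq hΓ hh]
  nth_rewrite 2 [← one_sub_weight_mul hΓ hh Y]
  simp only [Matrix.mul_sub, Matrix.sub_mul, Matrix.mul_one, Matrix.mul_assoc]

theorem dotProduct_conj_mulVec (X : Matrix ι κ ℝ) (W : Matrix κ κ ℝ) (v : ι → ℝ) :
    v ⬝ᵥ ((X * W * Xᵀ) *ᵥ v) = (Xᵀ *ᵥ v) ⬝ᵥ (W *ᵥ (Xᵀ *ᵥ v)) := by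
  rw [← Matrix.mulVec_mulVec, ← Matrix.mulVec_mulVec, Matrix.dotProduct_mulVec,
    Matrix.mulVec_transpose]

theorem dotProduct_mul_transpose_mulVec (X : Matrix ι κ ℝ) (v : ι → ℝ) :
    v ⬝ᵥ ((X * Xᵀ) *ᵥ v) = (Xᵀ *ᵥ v) ⬝ᵥ (Xᵀ *ᵥ v) := by
  rw [← Matrix.mulVec_mulVec, Matrix.dotProduct_mulVec, Matrix.mulVec_transpose]

theorem dotProduct_one_add_mulVec (Y : Matrix ο κ ℝ) (x : κ → ℝ) :
    x ⬝ᵥ ((1 + h • (Yᵀ * Γ⁻¹ * Y)) *ᵥ x) = x ⬝ᵥ x + h * ((Y *ᵥ x) ⬝ᵥ (Γ⁻¹ *ᵥ (Y *ᵥ x))) := by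
  have := dotProduct_conj_mulVec Yᵀ Γ⁻¹ x
  rw [Matrix.transpose_transpose] at this
  rw [Matrix.add_mulVec, Matrix.one_mulVec, dotProduct_add, Matrix.smul_mulVec, dotProduct_smul,
    this, smul_eq_mul]

theorem le_dotProduct_weight (hΓ : Γ.PosDef) (hh : 0 < h) (Y : Matrix ο κ ℝ) {q : ℝ} (hq : 0 ≤ q)
    (hY : ∀ x, (Y *ᵥ x) ⬝ᵥ (Γ⁻¹ *ᵥ (Y *ᵥ x)) ≤ q * (x ⬝ᵥ x)) (v : κ → ℝ) :
    (1 + h * q)⁻¹ * (v ⬝ᵥ v) ≤ v ⬝ᵥ (weight Γ h Y *ᵥ v) := by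
  have hp : 0 < 1 + h * q := by positivity
  have h1 := two_mul_dotProduct_sub_le (posDef_one_add hΓ hh Y) v ((1 + h * q)⁻¹ • v)
  rw [dotProduct_one_add_mulVec] at h1
  have h2 := mul_le_mul_of_nonneg_left (hY ((1 + h * q)⁻¹ • v)) hh.le
  rw [dotProduct_smul, dotProduct_smul, smul_dotProduct] at h1
  rw [dotProduct_smul (1 + h * q)⁻¹ _ v, smul_dotProduct] at h2
  simp only [smul_eq_mul] at h1 h2
  have h3 : (1 + h * q) * ((1 + h * q)⁻¹ * ((1 + h * q)⁻¹ * (v ⬝ᵥ v)))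
      = (1 + h * q)⁻¹ * (v ⬝ᵥ v) := by
    field_simp
  change _ ≤ v ⬝ᵥ ((1 + h • (Yᵀ * Γ⁻¹ * Y))⁻¹ *ᵥ v)
  linarith

/-- `|W v|² ≤ v ⬝ W v ≤ |v|²`, since the weight matrix `W` is the inverse of a matrix `≥ I`. -/
theorem weight_mulVec_dotProduct_self_le (hΓ : Γ.PosDef) (hh : 0 < h) (Y : Matrix ο κ ℝ)
    (v : κ → ℝ) :
    (weight Γ h Y *ᵥ v) ⬝ᵥ (weight Γ h Y *ᵥ v) ≤ v ⬝ᵥ (weight Γ h Y *ᵥ v) := by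
  have h1 := dotProduct_one_add_mulVec (Γ := Γ) (h := h) Y (weight Γ h Y *ᵥ v)
  have h2 : (1 + h • (Yᵀ * Γ⁻¹ * Y)) *ᵥ (weight Γ h Y *ᵥ v) = v :=
    mulVec_inv_mulVec (posDef_one_add hΓ hh Y) v
  rw [h2, dotProduct_comm _ v] at h1
  have h3 := mul_nonneg hh.le
    (dotProduct_mulVec_nonneg hΓ.inv.posSemidef (Y *ᵥ (weight Γ h Y *ᵥ v)))
  linarith

theorem dotProduct_weight_le (hΓ : Γ.PosDef) (hh : 0 < h) (Y : Matrix ο κ ℝ) (v : κ → ℝ) :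
    v ⬝ᵥ (weight Γ h Y *ᵥ v) ≤ v ⬝ᵥ v := by
  have h1 := weight_mulVec_dotProduct_self_le hΓ hh Y v
  have h2 := two_mul_dotProduct_le (Matrix.PosSemidef.one (n := κ) (R := ℝ)) v (weight Γ h Y *ᵥ v)
  rw [Matrix.one_mulVec, Matrix.one_mulVec] at h2
  linarith

theorem dotProduct_inv_mulVec_le {S : Matrix ι ι ℝ} (hS : S.PosDef) (X : Matrix ι κ ℝ) {c : ℝ} (hc : 0 < c)
    (hX : ∀ v, v ⬝ᵥ ((X * Xᵀ) *ᵥ v) ≤ c * (v ⬝ᵥ (S *ᵥ v))) (x : κ → ℝ) :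
    (X *ᵥ x) ⬝ᵥ (S⁻¹ *ᵥ (X *ᵥ x)) ≤ c * (x ⬝ᵥ x) := by
  set p := X *ᵥ x
  have h0 := dotProduct_mulVec_nonneg hS.inv.posSemidef p
  have h1 := hX (S⁻¹ *ᵥ p)
  rw [mulVec_inv_mulVec hS, dotProduct_mul_transpose_mulVec, dotProduct_comm (S⁻¹ *ᵥ p) p] at h1
  set a := Xᵀ *ᵥ (S⁻¹ *ᵥ p)
  have h2 : p ⬝ᵥ (S⁻¹ *ᵥ p) = a ⬝ᵥ x := by
    rw [dotProduct_comm p, Matrix.dotProduct_mulVec, ← Matrix.mulVec_transpose]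
  have h3 : (a ⬝ᵥ x) ^ 2 ≤ (a ⬝ᵥ a) * (x ⬝ᵥ x) := by
    have := Finset.sum_mul_sq_le_sq_mul_sq Finset.univ a x
    simpa [dotProduct, sq] using this
  have hx : 0 ≤ x ⬝ᵥ x := by rw [dotProduct_self_eq_norm_sq]; positivity
  rw [h2] at h0 h1 ⊢
  rcases h0.eq_or_lt with h0 | h0
  · rw [← h0]
    positivity
  · nlinarith

/-- If `X Xᵀ ≤ c S` and `Yᵀ Γ⁻¹ Y ≥ Xᵀ S⁻¹ X`, then `X W Xᵀ ≤ (c⁻¹ + h)⁻¹ S`. This is the contraction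
of the covariance under a Kalman step for observations that include the unknown itself. -/
theorem dotProduct_conj_weight_le {S : Matrix ι ι ℝ} (hS : S.PosDef) (hΓ : Γ.PosDef) (hh : 0 < h)
    (X : Matrix ι κ ℝ) (Y : Matrix ο κ ℝ) {c : ℝ} (hc : 0 < c)
    (hX : ∀ v, v ⬝ᵥ ((X * Xᵀ) *ᵥ v) ≤ c * (v ⬝ᵥ (S *ᵥ v)))
    (hXY : ∀ x, (X *ᵥ x) ⬝ᵥ (S⁻¹ *ᵥ (X *ᵥ x)) ≤ (Y *ᵥ x) ⬝ᵥ (Γ⁻¹ *ᵥ (Y *ᵥ x))) (v : ι → ℝ) :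
    v ⬝ᵥ ((X * weight Γ h Y * Xᵀ) *ᵥ v) ≤ (c⁻¹ + h)⁻¹ * (v ⬝ᵥ (S *ᵥ v)) := by
  rw [dotProduct_conj_mulVec]
  -- the quadratic form of `W` is attained in its variational characterization at `x`
  set x := weight Γ h Y *ᵥ (Xᵀ *ᵥ v) with hx
  have h1 := dotProduct_one_add_mulVec (Γ := Γ) (h := h) Y x
  have h2 : (1 + h • (Yᵀ * Γ⁻¹ * Y)) *ᵥ x = Xᵀ *ᵥ v :=
    mulVec_inv_mulVec (posDef_one_add hΓ hh Y) _
  rw [h2, dotProduct_comm x] at h1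
  have h3 : (Xᵀ *ᵥ v) ⬝ᵥ x = v ⬝ᵥ (X *ᵥ x) := by
    rw [Matrix.dotProduct_mulVec v, ← Matrix.mulVec_transpose]
  have h4 := dotProduct_inv_mulVec_le hS X hc hX x
  have h5 := mul_le_mul_of_nonneg_left (hXY x) hh.le
  set p := X *ᵥ x
  set k := c⁻¹ + h with hk
  have hkp : 0 < k := by positivity
  have h6 := two_mul_dotProduct_sub_le hS.inv v (k • p)
  rw [Matrix.nonsing_inv_nonsing_inv _ ((Matrix.isUnit_iff_isUnit_det _).1 hS.isUnit),
    Matrix.mulVec_smul, dotProduct_smul, dotProduct_smul, smul_dotProduct] at h6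
  simp only [smul_eq_mul] at h6
  have h7 : c⁻¹ * (p ⬝ᵥ (S⁻¹ *ᵥ p)) ≤ x ⬝ᵥ x := by
    rw [inv_mul_le_iff₀ hc]
    exact h4
  have h8 : k * (p ⬝ᵥ (S⁻¹ *ᵥ p)) ≤ (Xᵀ *ᵥ v) ⬝ᵥ x := by
    rw [h1, hk, add_mul]
    linarith
  have h9 : k * (k * (p ⬝ᵥ (S⁻¹ *ᵥ p))) ≤ k * ((Xᵀ *ᵥ v) ⬝ᵥ x) := by gcongr
  rw [← h3] at h6
  rw [le_inv_mul_iff₀ hkp]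
  linarith

end Weight

/-! ### Deviation matrices of an ensemble -/

section Ensemble

variable {ι κ : Type} [Fintype ι] [DecidableEq ι] [Fintype κ] [DecidableEq κ] {K : ℕ}

/-- The matrix whose `i`-th column is the deviation of the `i`-th ensemble member from the mean,
scaled by `K^{-1/2}` so that `D Dᵀ` is the sample covariance. -/
noncomputable def devMat (x : Fin K → EuclideanSpace ℝ ι) : Matrix ι (Fin K) ℝ :=
  Matrix.of fun j i => (√(K : ℝ))⁻¹ * (x i - ensMean x) j

/-- The total variance `(1/K) ∑ᵢ ‖xᵢ - x̄‖²` of an ensemble: the trace of its covariance. -/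
noncomputable def ensVar (x : Fin K → EuclideanSpace ℝ ι) : ℝ :=
  (K : ℝ)⁻¹ * ∑ i, ‖x i - ensMean x‖ ^ 2

theorem inv_sqrt_mul_self (K : ℕ) : (√(K : ℝ))⁻¹ * (√(K : ℝ))⁻¹ = (K : ℝ)⁻¹ := by
  rw [← mul_inv, Real.mul_self_sqrt (Nat.cast_nonneg K)]

theorem ensCov_eq (x : Fin K → EuclideanSpace ℝ ι) (w : Fin K → EuclideanSpace ℝ κ) :
    ensCov x w = devMat x * (devMat w)ᵀ := by
  ext j l
  rw [ensCov, Matrix.smul_apply, Matrix.sum_apply, Matrix.mul_apply, smul_eq_mul, Finset.mul_sum,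
    ← inv_sqrt_mul_self]
  refine Finset.sum_congr rfl fun i _ => ?_
  simp only [devMat, Matrix.transpose_apply, Matrix.of_apply, Matrix.vecMulVec_apply]
  ring

theorem sum_sq_devMat (x : Fin K → EuclideanSpace ℝ ι) :
    ∑ j, ∑ i, devMat x j i ^ 2 = ensVar x := by
  rw [Finset.sum_comm, ensVar, Finset.mul_sum]
  refine Finset.sum_congr rfl fun i _ => ?_
  rw [EuclideanSpace.real_norm_sq_eq, Finset.mul_sum, ← inv_sqrt_mul_self]
  refine Finset.sum_congr rfl fun j _ => ?_
  simp only [devMat, Matrix.of_apply]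
  ring

theorem ensVar_nonneg (x : Fin K → EuclideanSpace ℝ ι) : 0 ≤ ensVar x := by
  unfold ensVar
  positivity

/-- The Frobenius bound for a matrix-vector product. -/
theorem mulVec_dotProduct_self_le (A : Matrix ι κ ℝ) (a : κ → ℝ) :
    (A *ᵥ a) ⬝ᵥ (A *ᵥ a) ≤ (∑ j, ∑ i, A j i ^ 2) * (a ⬝ᵥ a) := by
  rw [dotProduct, Finset.sum_mul]
  refine Finset.sum_le_sum fun j _ => ?_
  have := Finset.sum_mul_sq_le_sq_mul_sq Finset.univ (A j) a
  simpa [dotProduct, Matrix.mulVec, sq] using this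

theorem devMat_mulVec_le (x : Fin K → EuclideanSpace ℝ ι) (a : Fin K → ℝ) :
    (devMat x *ᵥ a) ⬝ᵥ (devMat x *ᵥ a) ≤ ensVar x * (a ⬝ᵥ a) := by
  rw [← sum_sq_devMat]
  exact mulVec_dotProduct_self_le _ _

theorem devMat_transpose_mulVec_le (x : Fin K → EuclideanSpace ℝ ι) (a : ι → ℝ) :
    ((devMat x)ᵀ *ᵥ a) ⬝ᵥ ((devMat x)ᵀ *ᵥ a) ≤ ensVar x * (a ⬝ᵥ a) := by
  rw [← sum_sq_devMat, Finset.sum_comm]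
  exact mulVec_dotProduct_self_le _ _

theorem ensVar_le_of_cov_le (x : Fin K → EuclideanSpace ℝ ι) {S : Matrix ι ι ℝ} {c : ℝ}
    (h : ∀ v, v ⬝ᵥ (ensCov x x *ᵥ v) ≤ c * (v ⬝ᵥ (S *ᵥ v))) : ensVar x ≤ c * S.trace := by
  rw [← sum_sq_devMat, Matrix.trace, Finset.mul_sum]
  refine Finset.sum_le_sum fun j _ => ?_
  have hj := h (Pi.single j 1)
  simp only [Matrix.mulVec_single_one, single_one_dotProduct, Matrix.col_apply] at hj
  rw [ensCov_eq, Matrix.mul_apply] at hj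
  simpa [sq] using hj

theorem ensMean_add (x w : Fin K → EuclideanSpace ℝ ι) :
    ensMean (fun i => x i + w i) = ensMean x + ensMean w := by
  simp only [ensMean, Finset.sum_add_distrib, smul_add]

theorem ensMean_map (A : EuclideanSpace ℝ ι →L[ℝ] EuclideanSpace ℝ κ)
    (x : Fin K → EuclideanSpace ℝ ι) : ensMean (fun i => A (x i)) = A (ensMean x) := by
  simp only [ensMean, map_smul, map_sum]

theorem devMat_add (x w : Fin K → EuclideanSpace ℝ ι) :
    devMat (fun i => x i + w i) = devMat x + devMat w := by
  ext j i
  simp only [devMat, ensMean_add, Matrix.of_apply, Matrix.add_apply, PiLp.sub_apply,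
    PiLp.add_apply]
  ring

theorem devMat_transpose_mulVec_apply (x : Fin K → EuclideanSpace ℝ ι) (w : EuclideanSpace ℝ ι)
    (i : Fin K) :
    ((devMat x)ᵀ *ᵥ w.ofLp) i = (√(K : ℝ))⁻¹ * inner ℝ (x i - ensMean x) w := by
  rw [EuclideanSpace.inner_eq_star_dotProduct, dotProduct, Finset.mul_sum, Matrix.mulVec,
    dotProduct]
  refine Finset.sum_congr rfl fun j _ => ?_
  simp [devMat]
  ring

theorem devMat_map_transpose_mulVec (A : EuclideanSpace ℝ ι →L[ℝ] EuclideanSpace ℝ κ)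
    (x : Fin K → EuclideanSpace ℝ ι) (w : EuclideanSpace ℝ κ) :
    (devMat (fun i => A (x i)))ᵀ *ᵥ w.ofLp = (devMat x)ᵀ *ᵥ (A.adjoint w).ofLp := by
  ext i
  rw [devMat_transpose_mulVec_apply, devMat_transpose_mulVec_apply, ensMean_map, ← map_sub,
    ContinuousLinearMap.adjoint_inner_right]

/-- The mean minimizes the mean squared distance. -/
theorem ensVar_le (x : Fin K → EuclideanSpace ℝ ι) (b : EuclideanSpace ℝ ι) :
    ensVar x ≤ (K : ℝ)⁻¹ * ∑ i, ‖x i - b‖ ^ 2 := by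
  refine mul_le_mul_of_nonneg_left ?_ (by positivity)
  rcases K.eq_zero_or_pos with rfl | hK
  · simp
  have h1 : ∑ i, (x i - ensMean x) = 0 := by
    rw [Finset.sum_sub_distrib, Finset.sum_const, Finset.card_univ, Fintype.card_fin, ensMean,
      ← Nat.cast_smul_eq_nsmul ℝ, smul_smul, mul_inv_cancel₀ (by positivity), one_smul, sub_self]
  have h2 : ∀ i, ‖x i - b‖ ^ 2 = ‖x i - ensMean x‖ ^ 2
      + 2 * inner ℝ (x i - ensMean x) (ensMean x - b) + ‖ensMean x - b‖ ^ 2 := fun i => by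
    rw [← norm_add_sq_real, sub_add_sub_cancel]
  simp only [h2, Finset.sum_add_distrib]
  rw [← Finset.mul_sum, ← sum_inner, h1, inner_zero_left]
  have : 0 ≤ ∑ _i : Fin K, ‖ensMean x - b‖ ^ 2 := by positivity
  linarith

theorem ensVar_comp_le {H : EuclideanSpace ℝ ι → EuclideanSpace ℝ κ} {M : ℝ}
    (hH : ∀ a b, ‖H a - H b‖ ≤ M * ‖a - b‖) (x : Fin K → EuclideanSpace ℝ ι) :
    ensVar (fun i => H (x i)) ≤ M ^ 2 * ensVar x := by
  refine (ensVar_le _ (H (ensMean x))).trans ?_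
  rw [ensVar, mul_left_comm]
  refine mul_le_mul_of_nonneg_left ?_ (by positivity)
  rw [Finset.mul_sum]
  refine Finset.sum_le_sum fun i _ => ?_
  rw [← mul_pow]
  exact pow_le_pow_left₀ (norm_nonneg _) (hH _ _) 2

/-- The variance of the linearization error of `H` is quadratic in the variance of the
ensemble. -/
theorem ensVar_remainder_le {H : EuclideanSpace ℝ ι → EuclideanSpace ℝ κ} {M : ℝ}
    (A : EuclideanSpace ℝ ι →L[ℝ] EuclideanSpace ℝ κ) (x : Fin K → EuclideanSpace ℝ ι)
    (hH : ∀ a, ‖H a - H (ensMean x) - A (a - ensMean x)‖ ≤ M * ‖a - ensMean x‖ ^ 2) :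
    ensVar (fun i => H (x i) - A (x i)) ≤ M ^ 2 * K * ensVar x ^ 2 := by
  refine (ensVar_le _ (H (ensMean x) - A (ensMean x))).trans ?_
  rcases K.eq_zero_or_pos with rfl | hK
  · simp
  have h1 : ∀ i, ‖H (x i) - A (x i) - (H (ensMean x) - A (ensMean x))‖ ^ 2
      ≤ M ^ 2 * (‖x i - ensMean x‖ ^ 2) ^ 2 := fun i => by
    rw [← mul_pow]
    refine pow_le_pow_left₀ (norm_nonneg _) ?_ 2
    have h := hH (x i)
    rwa [map_sub, sub_sub_sub_comm] at h
  have h2 : ∑ i, (‖x i - ensMean x‖ ^ 2) ^ 2 ≤ (∑ i, ‖x i - ensMean x‖ ^ 2) ^ 2 :=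
    Finset.sum_sq_le_sq_sum_of_nonneg fun i _ => by positivity
  calc (K : ℝ)⁻¹ * ∑ i, ‖H (x i) - A (x i) - (H (ensMean x) - A (ensMean x))‖ ^ 2
      ≤ (K : ℝ)⁻¹ * (M ^ 2 * (∑ i, ‖x i - ensMean x‖ ^ 2) ^ 2) := by
        refine mul_le_mul_of_nonneg_left ?_ (by positivity)
        refine (Finset.sum_le_sum fun i _ => h1 i).trans ?_
        rw [← Finset.mul_sum]
        gcongr
    _ = M ^ 2 * K * ensVar x ^ 2 := by
        rw [ensVar]
        field_simp

end Ensemble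

/-! ### The augmented observation operator -/

section Aug

variable {du dy K : ℕ} {G : Vec du → Vec dy} {y : Vec dy}
  {Γ : Matrix (Fin dy) (Fin dy) ℝ} {S : Matrix (Fin du) (Fin du) ℝ}

theorem augCov_inv (hΓ : Γ.PosDef) (hS : S.PosDef) :
    (augCov Γ S)⁻¹ = Matrix.fromBlocks Γ⁻¹ 0 0 S⁻¹ := by
  refine Matrix.inv_eq_right_inv ?_
  rw [augCov, Matrix.fromBlocks_multiply,
    Matrix.mul_nonsing_inv _ ((Matrix.isUnit_iff_isUnit_det _).1 hΓ.isUnit),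
    Matrix.mul_nonsing_inv _ ((Matrix.isUnit_iff_isUnit_det _).1 hS.isUnit)]
  simp [Matrix.fromBlocks_one]

theorem dotProduct_fromBlocks_mulVec {α β : Type} [Fintype α] [Fintype β]
    (A : Matrix α α ℝ) (B : Matrix β β ℝ) (v : α ⊕ β → ℝ) :
    v ⬝ᵥ (Matrix.fromBlocks A 0 0 B *ᵥ v)
      = (v ∘ Sum.inl) ⬝ᵥ (A *ᵥ (v ∘ Sum.inl)) + (v ∘ Sum.inr) ⬝ᵥ (B *ᵥ (v ∘ Sum.inr)) := by
  rw [Matrix.fromBlocks_mulVec]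
  simp [dotProduct, Fintype.sum_sum_type]

theorem augCov_posDef (hΓ : Γ.PosDef) (hS : S.PosDef) : (augCov Γ S).PosDef := by
  refine Matrix.PosDef.of_dotProduct_mulVec_pos ?_ fun v hv => ?_
  · rw [augCov, Matrix.isHermitian_fromBlocks_iff]
    exact ⟨hΓ.1, by simp, by simp, hS.1⟩
  · rw [star_trivial, augCov, dotProduct_fromBlocks_mulVec]
    by_cases h1 : v ∘ Sum.inl = 0
    · have h2 : v ∘ Sum.inr ≠ 0 := fun h2 => hv (by
        ext i
        rcases i with i | i
        · exact congrFun h1 i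
        · exact congrFun h2 i)
      have := hS.dotProduct_mulVec_pos h2
      rw [star_trivial] at this
      linarith [dotProduct_mulVec_nonneg hΓ.posSemidef (v ∘ Sum.inl)]
    · have := hΓ.dotProduct_mulVec_pos h1
      rw [star_trivial] at this
      linarith [dotProduct_mulVec_nonneg hS.posSemidef (v ∘ Sum.inr)]

theorem loss_eq (hΓ : Γ.PosDef) (hS : S.PosDef) (m : Vec du) :
    loss G y Γ S m = (augMap G m - augData du y).ofLp ⬝ᵥ
      ((augCov Γ S)⁻¹ *ᵥ (augMap G m - augData du y).ofLp) := by
  rw [augCov_inv hΓ hS, dotProduct_fromBlocks_mulVec, loss, mahalanobisSq, mahalanobisSq]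
  have h1 : (augMap G m - augData du y).ofLp ∘ Sum.inl = (G m - y).ofLp := by
    ext i
    simp [augMap, augData]
  have h2 : (augMap G m - augData du y).ofLp ∘ Sum.inr = m.ofLp := by
    ext i
    simp [augMap, augData]
  rw [h1, h2]

theorem loss_nonneg (hΓ : Γ.PosDef) (hS : S.PosDef) (m : Vec du) : 0 ≤ loss G y Γ S m := by
  rw [loss_eq hΓ hS]
  exact dotProduct_mulVec_nonneg (augCov_posDef hΓ hS).inv.posSemidef _

theorem devMat_augMap_inr (u : Fin K → Vec du) (j : Fin du) (i : Fin K) :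
    devMat (fun i => augMap G (u i)) (Sum.inr j) i = devMat u j i := by
  simp [devMat, ensMean, augMap]

/-- Since the unknown is part of the observation, `Yᵀ Γ₊⁻¹ Y ≥ Xᵀ S⁻¹ X` for the deviation matrices
`Y` of the predictions and `X` of the ensemble. -/
theorem devMat_inv_le (hΓ : Γ.PosDef) (hS : S.PosDef) (u : Fin K → Vec du) (x : Fin K → ℝ) :
    (devMat u *ᵥ x) ⬝ᵥ (S⁻¹ *ᵥ (devMat u *ᵥ x)) ≤
      (devMat (fun i => augMap G (u i)) *ᵥ x) ⬝ᵥ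
        ((augCov Γ S)⁻¹ *ᵥ (devMat (fun i => augMap G (u i)) *ᵥ x)) := by
  rw [augCov_inv hΓ hS, dotProduct_fromBlocks_mulVec]
  have h : (devMat (fun i => augMap G (u i)) *ᵥ x) ∘ Sum.inr = devMat u *ᵥ x := by
    ext j
    simp only [Function.comp, Matrix.mulVec, dotProduct, devMat_augMap_inr]
  rw [h]
  exact le_add_of_nonneg_left (dotProduct_mulVec_nonneg hΓ.inv.posSemidef _)

theorem gain_eq (hΓ : Γ.PosDef) (hS : S.PosDef) {h : ℝ} (hh : 0 < h) (u : Fin K → Vec du) :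
    gain G Γ S h u = h • (devMat u * weight (augCov Γ S) h (devMat fun i => augMap G (u i)) *
      (devMat fun i => augMap G (u i))ᵀ * (augCov Γ S)⁻¹) := by
  rw [gain, ensCov_eq, ensCov_eq, Matrix.mul_assoc, transpose_mul_inv_eq (augCov_posDef hΓ hS) hh,
    Matrix.mul_smul]
  simp only [Matrix.mul_assoc]

theorem cov_sub_gain_eq (hΓ : Γ.PosDef) (hS : S.PosDef) {h : ℝ} (hh : 0 < h) (u : Fin K → Vec du) :
    ensCov u u - gain G Γ S h u * ensCov (fun i => augMap G (u i)) u =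
      devMat u * weight (augCov Γ S) h (devMat fun i => augMap G (u i)) * (devMat u)ᵀ := by
  rw [← cov_sub_gain_mul (augCov_posDef hΓ hS) hh, gain]
  simp only [ensCov_eq]

end Aug

/-! ### Second order bounds -/

section Calculus

theorem norm_sub_le_of_fderiv_le {E F : Type} [NormedAddCommGroup E] [NormedSpace ℝ E]
    [NormedAddCommGroup F] [NormedSpace ℝ F] {H : E → F} (h1 : Differentiable ℝ H) {M : ℝ}
    (hM : ∀ x, ‖fderiv ℝ H x‖ ≤ M) (a b : E) : ‖H a - H b‖ ≤ M * ‖a - b‖ :=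
  convex_univ.norm_image_sub_le_of_norm_fderiv_le (fun x _ => h1 x) (fun x _ => hM x)
    (Set.mem_univ b) (Set.mem_univ a)

/-- Taylor's bound; only the values `D²H(x)[v, v]` on the diagonal are needed, because the second
derivative is only taken along a line. -/
theorem norm_taylor_le {E F : Type} [NormedAddCommGroup E] [NormedSpace ℝ E]
    [NormedAddCommGroup F] [NormedSpace ℝ F] {H : E → F} (h1 : Differentiable ℝ H)
    (h2 : Differentiable ℝ (fderiv ℝ H)) {M : ℝ}
    (hM : ∀ x v, ‖fderiv ℝ (fderiv ℝ H) x v v‖ ≤ M * ‖v‖ ^ 2) (a b : E) :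
    ‖H a - H b - fderiv ℝ H b (a - b)‖ ≤ M * ‖a - b‖ ^ 2 := by
  set v := a - b with hv
  have hM0 : 0 ≤ M * ‖v‖ ^ 2 := (norm_nonneg _).trans (hM b v)
  have hline : ∀ t : ℝ, HasDerivAt (fun t : ℝ => b + t • v) v t := fun t => by
    simpa using ((hasDerivAt_id t).smul_const v).const_add b
  have hd1 : ∀ t : ℝ, HasDerivAt (fun t : ℝ => H (b + t • v)) (fderiv ℝ H (b + t • v) v) t :=
    fun t => (h1 _).hasFDerivAt.comp_hasDerivAt t (hline t)
  have hd2 : ∀ t : ℝ, HasDerivAt (fun t : ℝ => fderiv ℝ H (b + t • v) v)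
      (fderiv ℝ (fderiv ℝ H) (b + t • v) v v) t := fun t => by
    simpa using ((h2 _).hasFDerivAt.comp_hasDerivAt t (hline t)).clm_apply (hasDerivAt_const t v)
  have hb1 : ∀ t ∈ Set.Icc (0 : ℝ) 1,
      ‖fderiv ℝ H (b + t • v) v - fderiv ℝ H b v‖ ≤ M * ‖v‖ ^ 2 := fun t ht => by
    have := norm_image_sub_le_of_norm_deriv_le_segment'
      (fun s _ => (hd2 s).hasDerivWithinAt) (fun s _ => hM (b + s • v) v) t ht
    simp only [zero_smul, add_zero, sub_zero] at this
    exact this.trans (mul_le_of_le_one_right hM0 ht.2)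
  have hd3 : ∀ t : ℝ, HasDerivAt (fun t : ℝ => H (b + t • v) - t • fderiv ℝ H b v)
      (fderiv ℝ H (b + t • v) v - fderiv ℝ H b v) t := fun t => by
    simpa using (hd1 t).fun_sub ((hasDerivAt_id t).smul_const (fderiv ℝ H b v))
  have := norm_image_sub_le_of_norm_deriv_le_segment_01'
    (fun t _ => (hd3 t).hasDerivWithinAt) (fun t ht => hb1 t ⟨ht.1, ht.2.le⟩)
  simp only [one_smul, zero_smul, add_zero, sub_zero] at this
  rwa [hv, add_sub_cancel, ← hv, sub_right_comm] at this

end Calculus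

/-! ### One step of the iteration -/

section Step

variable {du dy K : ℕ} {G : Vec du → Vec dy} {y : Vec dy}
  {Γ : Matrix (Fin dy) (Fin dy) ℝ} {S : Matrix (Fin du) (Fin du) ℝ}

theorem gradient_loss (hΓ : Γ.PosDef) (hS : S.PosDef) (hG : Differentiable ℝ (augMap G))
    (m : Vec du) :
    gradient (loss G y Γ S) m = (2 : ℝ) • (fderiv ℝ (augMap G) m).adjoint
      (WithLp.toLp 2 ((augCov Γ S)⁻¹ *ᵥ (augMap G m - augData du y).ofLp)) := by
  set L := Matrix.toEuclideanCLM (𝕜 := ℝ) (augCov Γ S)⁻¹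
  have hL : ∀ e, L e = WithLp.toLp 2 ((augCov Γ S)⁻¹ *ᵥ e.ofLp) := fun e => rfl
  have hloss : loss G y Γ S = fun m => inner ℝ (augMap G m - augData du y)
      (L (augMap G m - augData du y)) := by
    ext m
    rw [loss_eq hΓ hS, dotProduct_eq_inner]
    rfl
  refine HasGradientAt.gradient ?_
  rw [hasGradientAt_iff_hasFDerivAt, hloss]
  have he : HasFDerivAt (fun m => augMap G m - augData du y) (fderiv ℝ (augMap G) m) m :=
    (hG m).hasFDerivAt.sub_const _
  refine (he.inner ℝ (L.hasFDerivAt.comp m he)).congr_fderiv (ContinuousLinearMap.ext fun v => ?_)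
  have hsymm := dotProduct_mulVec_comm (augCov_posDef hΓ hS).inv.1
    (augMap G m - augData du y).ofLp (fderiv ℝ (augMap G) m v).ofLp
  rw [dotProduct_eq_inner, dotProduct_eq_inner] at hsymm
  simp only [← hL]
  change inner ℝ (augMap G m - augData du y) (L (fderiv ℝ (augMap G) m v)) =
    inner ℝ (fderiv ℝ (augMap G) m v) (L (augMap G m - augData du y)) at hsymm
  rw [InnerProductSpace.toDual_apply_apply, inner_smul_left,
    ContinuousLinearMap.adjoint_inner_left]
  change inner ℝ (augMap G m - augData du y) (L (fderiv ℝ (augMap G) m v)) +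
    inner ℝ (fderiv ℝ (augMap G) m v) (L (augMap G m - augData du y)) = _
  rw [hsymm, real_inner_comm (fderiv ℝ (augMap G) m v), conj_trivial, two_mul]

/-- The upper bound of the covariance recursion. -/
theorem cov_update_le (hΓ : Γ.PosDef) (hS : S.PosDef) {h c : ℝ} (hh : 0 < h) (hc : 0 < c)
    (u : Fin K → Vec du) (hu : ∀ v, v ⬝ᵥ (ensCov u u *ᵥ v) ≤ c * (v ⬝ᵥ (S *ᵥ v))) (a : ℝ)
    (v : Fin du → ℝ) :
    v ⬝ᵥ ((ensCov u u - gain G Γ S h u * ensCov (fun i => augMap G (u i)) u + a • S) *ᵥ v)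
      ≤ ((c⁻¹ + h)⁻¹ + a) * (v ⬝ᵥ (S *ᵥ v)) := by
  rw [cov_sub_gain_eq hΓ hS hh, Matrix.add_mulVec, dotProduct_add, Matrix.smul_mulVec,
    dotProduct_smul, smul_eq_mul, add_mul]
  rw [ensCov_eq] at hu
  exact add_le_add_left (dotProduct_conj_weight_le hS (augCov_posDef hΓ hS) hh _ _ hc hu
    (devMat_inv_le hΓ hS u) v) _

/-- The quadratic form of `Yᵀ Γ₊⁻¹ Y` is bounded by the variance of the ensemble. -/
theorem devMat_augMap_le {M b : ℝ} (hM : ∀ a b, ‖augMap G a - augMap G b‖ ≤ M * ‖a - b‖)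
    (hb0 : 0 ≤ b)
    (hb : ∀ v : Fin dy ⊕ Fin du → ℝ, v ⬝ᵥ ((augCov Γ S)⁻¹ *ᵥ v) ≤ b * (v ⬝ᵥ v))
    (u : Fin K → Vec du) (x : Fin K → ℝ) :
    (devMat (fun i => augMap G (u i)) *ᵥ x) ⬝ᵥ
        ((augCov Γ S)⁻¹ *ᵥ (devMat (fun i => augMap G (u i)) *ᵥ x)) ≤
      b * M ^ 2 * ensVar u * (x ⬝ᵥ x) := by
  have hx : 0 ≤ x ⬝ᵥ x := by rw [dotProduct_self_eq_norm_sq]; positivity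
  refine (hb _).trans ?_
  rw [mul_assoc, mul_assoc]
  refine mul_le_mul_of_nonneg_left ((devMat_mulVec_le _ x).trans ?_) hb0
  rw [← mul_assoc]
  exact mul_le_mul_of_nonneg_right (ensVar_comp_le hM u) hx

/-- The lower bound of the covariance recursion. -/
theorem le_cov_update (hΓ : Γ.PosDef) (hS : S.PosDef) {M b : ℝ}
    (hM : ∀ a b, ‖augMap G a - augMap G b‖ ≤ M * ‖a - b‖) (hb0 : 0 ≤ b)
    (hb : ∀ v : Fin dy ⊕ Fin du → ℝ, v ⬝ᵥ ((augCov Γ S)⁻¹ *ᵥ v) ≤ b * (v ⬝ᵥ v))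
    {h c : ℝ} (hh : 0 < h)
    (u : Fin K → Vec du) (hu : ∀ v, c * (v ⬝ᵥ (S *ᵥ v)) ≤ v ⬝ᵥ (ensCov u u *ᵥ v)) (a : ℝ)
    (v : Fin du → ℝ) :
    ((1 + h * (b * M ^ 2 * ensVar u))⁻¹ * c + a) * (v ⬝ᵥ (S *ᵥ v)) ≤
    v ⬝ᵥ ((ensCov u u - gain G Γ S h u * ensCov (fun i => augMap G (u i)) u + a • S) *ᵥ v) := by
  have hV := ensVar_nonneg u
  rw [cov_sub_gain_eq hΓ hS hh, Matrix.add_mulVec, dotProduct_add, Matrix.smul_mulVec,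
    dotProduct_smul, smul_eq_mul, add_mul, dotProduct_conj_mulVec]
  refine add_le_add_left (le_trans ?_ (le_dotProduct_weight (augCov_posDef hΓ hS) hh _
    (by positivity) (devMat_augMap_le hM hb0 hb u) _)) _
  rw [mul_assoc, ← dotProduct_mul_transpose_mulVec, ← ensCov_eq]
  exact mul_le_mul_of_nonneg_left (hu v) (by positivity)

/-! ### Descent of the loss -/

/-- The quadratic upper bound for the loss. -/
theorem loss_add_le (hΓ : Γ.PosDef) (hS : S.PosDef) (h1 : Differentiable ℝ (augMap G))
    {M₁ M₂ b E : ℝ} (hM₁ : ∀ a b, ‖augMap G a - augMap G b‖ ≤ M₁ * ‖a - b‖)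
    (hM₂ : ∀ a b, ‖augMap G a - augMap G b - fderiv ℝ (augMap G) b (a - b)‖ ≤ M₂ * ‖a - b‖ ^ 2)
    (hb0 : 0 ≤ b)
    (hb : ∀ v : Fin dy ⊕ Fin du → ℝ, v ⬝ᵥ ((augCov Γ S)⁻¹ *ᵥ v) ≤ b * (v ⬝ᵥ v)) (m d : Vec du)
    (hE : ‖WithLp.toLp 2 ((augCov Γ S)⁻¹ *ᵥ (augMap G m - augData du y).ofLp)‖ ≤ E) :
    loss G y Γ S (m + d) ≤ loss G y Γ S m + inner ℝ (gradient (loss G y Γ S) m) d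
      + (2 * M₂ * E + b * M₁ ^ 2) * ‖d‖ ^ 2 := by
  set Λ := (augCov Γ S)⁻¹ with hΛ
  have hPD : Λ.PosDef := (augCov_posDef hΓ hS).inv
  set A := fderiv ℝ (augMap G) m with hA
  set e := augMap G m - augData du y with he
  set r := augMap G (m + d) - augMap G m - A d with hr
  set f := augMap G (m + d) - augMap G m with hf
  have hd : m + d - m = d := add_sub_cancel_left m d
  have hr' : ‖r‖ ≤ M₂ * ‖d‖ ^ 2 := by simpa only [hd] using hM₂ (m + d) m
  have hf' : ‖f‖ ≤ M₁ * ‖d‖ := by simpa only [hd] using hM₁ (m + d) m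
  have hsum : augMap G (m + d) - augData du y = e + f := by rw [he, hf]; abel
  have hfe : f = A d + r := by rw [hr]; abel
  rw [gradient_loss hΓ hS h1, inner_smul_left, ContinuousLinearMap.adjoint_inner_left, ← hΛ,
    ← he, ← hA]
  rw [loss_eq hΓ hS, loss_eq hΓ hS, hsum, ← hΛ, ← he, WithLp.ofLp_add, Matrix.mulVec_add,
    add_dotProduct, dotProduct_add, dotProduct_add, dotProduct_mulVec_comm hPD.1 e.ofLp f.ofLp]
  have h3 : f.ofLp ⬝ᵥ (Λ *ᵥ f.ofLp) ≤ b * M₁ ^ 2 * ‖d‖ ^ 2 := by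
    refine (hb _).trans ?_
    rw [dotProduct_self_eq_norm_sq, mul_assoc, ← mul_pow]
    exact mul_le_mul_of_nonneg_left (pow_le_pow_left₀ (norm_nonneg _) hf' 2) hb0
  have h4 : f.ofLp ⬝ᵥ (Λ *ᵥ e.ofLp) ≤
      inner ℝ (WithLp.toLp 2 (Λ *ᵥ e.ofLp)) (A d) + M₂ * ‖d‖ ^ 2 * E := by
    rw [dotProduct_eq_inner, real_inner_comm]
    change inner ℝ _ f ≤ _
    rw [hfe, inner_add_right]
    have h5 := real_inner_le_norm (WithLp.toLp 2 (Λ *ᵥ e.ofLp)) r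
    have h6 : ‖WithLp.toLp 2 (Λ *ᵥ e.ofLp)‖ * ‖r‖ ≤ E * (M₂ * ‖d‖ ^ 2) :=
      mul_le_mul hE hr' (norm_nonneg _) ((norm_nonneg _).trans hE)
    linarith
  simp only [conj_trivial]
  linarith

/-- The ensemble step in terms of the weight matrix: with the deviation matrices `X` of the ensemble
and `R` of the linearization errors, and with `Λ = Γ₊⁻¹`, the increment of the mean is
`-h X W (Xᵀ ∇ℓ(m) / 2 + Rᵀ Λ (H(m) - z))`. -/
theorem gain_mulVec_eq (hΓ : Γ.PosDef) (hS : S.PosDef) (h1 : Differentiable ℝ (augMap G))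
    {h : ℝ} (hh : 0 < h) (u : Fin K → Vec du) (m : Vec du) :
    gain G Γ S h u *ᵥ (augData du y - augMap G m).ofLp =
      -(h • (devMat u *ᵥ (weight (augCov Γ S) h (devMat fun i => augMap G (u i)) *ᵥ
        ((2 : ℝ)⁻¹ • ((devMat u)ᵀ *ᵥ (gradient (loss G y Γ S) m).ofLp) +
          (devMat fun i => augMap G (u i) - fderiv ℝ (augMap G) m (u i))ᵀ *ᵥ
            ((augCov Γ S)⁻¹ *ᵥ (augMap G m - augData du y).ofLp))))) := by
  set Λ := (augCov Γ S)⁻¹ with hΛ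
  set A := fderiv ℝ (augMap G) m with hA
  set e := augMap G m - augData du y with he
  have hsplit : devMat (fun i => augMap G (u i)) =
      devMat (fun i => A (u i)) + devMat (fun i => augMap G (u i) - A (u i)) := by
    rw [← devMat_add]
    congr 1
    ext1 i
    abel
  have hg : (2 : ℝ)⁻¹ • ((devMat u)ᵀ *ᵥ (gradient (loss G y Γ S) m).ofLp) =
      (devMat (fun i => A (u i)))ᵀ *ᵥ (Λ *ᵥ e.ofLp) := by
    have := devMat_map_transpose_mulVec A u (WithLp.toLp 2 (Λ *ᵥ e.ofLp))
    rw [gradient_loss hΓ hS h1, ← hΛ, ← he, ← hA, WithLp.ofLp_smul, Matrix.mulVec_smul, smul_smul,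
      inv_mul_cancel₀ two_ne_zero, one_smul, ← this]
  have hneg : augData du y - augMap G m = -e := by rw [he, neg_sub]
  rw [hneg, hg, ← Matrix.add_mulVec, ← Matrix.transpose_add, ← hsplit, gain_eq hΓ hS hh,
    WithLp.ofLp_neg, Matrix.mulVec_neg, Matrix.smul_mulVec, ← hΛ]
  simp only [Matrix.mulVec_mulVec, Matrix.mul_assoc]

/-- One step of the iteration decreases the loss, up to an error which is quadratic in the variance
of the ensemble, as soon as `h` times the variance is small. -/
theorem loss_step_le (hΓ : Γ.PosDef) (hS : S.PosDef) (h1 : Differentiable ℝ (augMap G))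
    {M₁ M₂ b E : ℝ} (hM₁ : ∀ a b, ‖augMap G a - augMap G b‖ ≤ M₁ * ‖a - b‖)
    (hM₂ : ∀ a b, ‖augMap G a - augMap G b - fderiv ℝ (augMap G) b (a - b)‖ ≤ M₂ * ‖a - b‖ ^ 2)
    (hM₂0 : 0 ≤ M₂) (hb0 : 0 ≤ b)
    (hb : ∀ v : Fin dy ⊕ Fin du → ℝ, v ⬝ᵥ ((augCov Γ S)⁻¹ *ᵥ v) ≤ b * (v ⬝ᵥ v))
    {h c : ℝ} (hh : 0 < h) (u : Fin K → Vec du)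
    (hE : ‖WithLp.toLp 2 ((augCov Γ S)⁻¹ *ᵥ
      (augMap G (ensMean u) - augData du y).ofLp)‖ ≤ E)
    (hc : ∀ v, c * (v ⬝ᵥ v) ≤ v ⬝ᵥ (ensCov u u *ᵥ v))
    (hsmall : 4 * (2 * M₂ * E + b * M₁ ^ 2) * (h * ensVar u) ≤ 1) :
    h / 8 * ((1 + h * (b * M₁ ^ 2 * ensVar u))⁻¹ *
        (c * ‖gradient (loss G y Γ S) (ensMean u)‖ ^ 2)) ≤
      loss G y Γ S (ensMean u) - loss G y Γ S (ensMean u +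
        WithLp.toLp 2 (gain G Γ S h u *ᵥ (augData du y - augMap G (ensMean u)).ofLp))
      + 3 / 2 * h * (M₂ ^ 2 * K * ensVar u ^ 2 * E ^ 2) := by
  have hPD := augCov_posDef hΓ hS
  have hV := ensVar_nonneg u
  have hE0 : 0 ≤ E := (norm_nonneg _).trans hE
  set m := ensMean u with hm
  set g := gradient (loss G y Γ S) m with hg
  set W := weight (augCov Γ S) h (devMat fun i => augMap G (u i)) with hW
  set w := (augCov Γ S)⁻¹ *ᵥ (augMap G m - augData du y).ofLp with hw
  set R := devMat fun i => augMap G (u i) - fderiv ℝ (augMap G) m (u i) with hR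
  set a := (devMat u)ᵀ *ᵥ g.ofLp with ha
  set r := Rᵀ *ᵥ w with hr
  set s := (2 : ℝ)⁻¹ • a + r with hs
  set d := gain G Γ S h u *ᵥ (augData du y - augMap G m).ofLp with hd
  have hstep : d = -(h • (devMat u *ᵥ (W *ᵥ s))) := gain_mulVec_eq hΓ hS h1 hh u m
  have hWp : W.PosDef := weight_posDef hPD hh _
  have hrW : r ⬝ᵥ (W *ᵥ r) ≤ r ⬝ᵥ r := dotProduct_weight_le hPD hh _ r
  have hrr : r ⬝ᵥ r ≤ M₂ ^ 2 * K * ensVar u ^ 2 * E ^ 2 := by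
    refine (devMat_transpose_mulVec_le _ w).trans ?_
    refine mul_le_mul (ensVar_remainder_le _ u fun x => hM₂ x m) ?_ ?_ (by positivity)
    · rw [dotProduct_self_eq_norm_sq]
      exact pow_le_pow_left₀ (norm_nonneg _) hE 2
    · rw [dotProduct_self_eq_norm_sq]
      positivity
  have haW : (1 + h * (b * M₁ ^ 2 * ensVar u))⁻¹ * (c * ‖g‖ ^ 2) ≤ a ⬝ᵥ (W *ᵥ a) := by
    refine le_trans ?_ (le_dotProduct_weight hPD hh _ (by positivity)
      (devMat_augMap_le hM₁ hb0 hb u) a)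
    refine mul_le_mul_of_nonneg_left ?_ (by positivity)
    rw [ha, ← dotProduct_mul_transpose_mulVec, ← ensCov_eq]
    have := hc g.ofLp
    rwa [dotProduct_self_eq_norm_sq] at this
  have hinner : inner ℝ g (WithLp.toLp 2 d) = -(h * (a ⬝ᵥ (W *ᵥ s))) := by
    have : inner ℝ g (WithLp.toLp 2 d) = g.ofLp ⬝ᵥ d := (dotProduct_eq_inner g.ofLp d).symm
    rw [this, hstep, dotProduct_neg, dotProduct_smul, smul_eq_mul, Matrix.dotProduct_mulVec,
      ← Matrix.mulVec_transpose]
  have has : a ⬝ᵥ (W *ᵥ s) = 2⁻¹ * (a ⬝ᵥ (W *ᵥ a)) + a ⬝ᵥ (W *ᵥ r) := by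
    rw [hs, Matrix.mulVec_add, Matrix.mulVec_smul, dotProduct_add, dotProduct_smul, smul_eq_mul]
  have hss : s ⬝ᵥ (W *ᵥ s) =
      4⁻¹ * (a ⬝ᵥ (W *ᵥ a)) + a ⬝ᵥ (W *ᵥ r) + r ⬝ᵥ (W *ᵥ r) := by
    rw [hs, Matrix.mulVec_add, Matrix.mulVec_smul, add_dotProduct, dotProduct_add, dotProduct_add,
      smul_dotProduct, smul_dotProduct, dotProduct_smul, dotProduct_smul,
      dotProduct_mulVec_comm hWp.1 r a]
    simp only [smul_eq_mul]
    ring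
  -- Young's inequality in the form `W`, for the pairs `(a/2, -r)` and `(a/2, r)`
  have hy1 : -(a ⬝ᵥ (W *ᵥ r)) ≤ 4⁻¹ * (a ⬝ᵥ (W *ᵥ a)) + r ⬝ᵥ (W *ᵥ r) := by
    have := two_mul_dotProduct_le hWp.posSemidef ((2 : ℝ)⁻¹ • a) (-r)
    simp only [Matrix.mulVec_smul, Matrix.mulVec_neg, dotProduct_smul, smul_dotProduct,
      dotProduct_neg, neg_dotProduct, smul_eq_mul] at this
    linarith
  have hy2 : a ⬝ᵥ (W *ᵥ r) ≤ 4⁻¹ * (a ⬝ᵥ (W *ᵥ a)) + r ⬝ᵥ (W *ᵥ r) := by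
    have := two_mul_dotProduct_le hWp.posSemidef ((2 : ℝ)⁻¹ • a) r
    simp only [Matrix.mulVec_smul, dotProduct_smul, smul_dotProduct, smul_eq_mul] at this
    linarith
  have hnorm : ‖WithLp.toLp 2 d‖ ^ 2 ≤ h ^ 2 * (ensVar u * (s ⬝ᵥ (W *ᵥ s))) := by
    rw [← dotProduct_self_eq_norm_sq, hstep, neg_dotProduct, dotProduct_neg, neg_neg,
      smul_dotProduct, dotProduct_smul, smul_eq_mul, smul_eq_mul, ← mul_assoc, ← sq]
    refine mul_le_mul_of_nonneg_left ((devMat_mulVec_le u _).trans ?_) (by positivity)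
    exact mul_le_mul_of_nonneg_left (weight_mulVec_dotProduct_self_le hPD hh _ s) hV
  have hloss := loss_add_le (y := y) hΓ hS h1 hM₁ hM₂ hb0 hb m (WithLp.toLp 2 d) hE
  rw [← hg, hinner, has] at hloss
  have hs0 := dotProduct_mulVec_nonneg hWp.posSemidef s
  set L := 2 * M₂ * E + b * M₁ ^ 2 with hL
  have hL0 : 0 ≤ L := by positivity
  have h5 : L * ‖WithLp.toLp 2 d‖ ^ 2 ≤ h / 4 * (s ⬝ᵥ (W *ᵥ s)) := by
    calc L * ‖WithLp.toLp 2 d‖ ^ 2 ≤ L * (h ^ 2 * (ensVar u * (s ⬝ᵥ (W *ᵥ s)))) := by gcongr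
      _ = (4 * L * (h * ensVar u)) * (h / 4 * (s ⬝ᵥ (W *ᵥ s))) := by ring
      _ ≤ 1 * (h / 4 * (s ⬝ᵥ (W *ᵥ s))) := by gcongr
      _ = _ := one_mul _
  have h6 : h * -(a ⬝ᵥ (W *ᵥ r)) ≤ h * (4⁻¹ * (a ⬝ᵥ (W *ᵥ a)) + r ⬝ᵥ (W *ᵥ r)) := by gcongr
  have h7 : h / 4 * (s ⬝ᵥ (W *ᵥ s)) ≤ h / 4 * (2⁻¹ * (a ⬝ᵥ (W *ᵥ a)) + 2 * (r ⬝ᵥ (W *ᵥ r))) := by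
    gcongr
    linarith
  have h8 : h * (r ⬝ᵥ (W *ᵥ r)) ≤ h * (M₂ ^ 2 * K * ensVar u ^ 2 * E ^ 2) := by
    gcongr
    exact hrW.trans hrr
  have h9 : h / 8 * ((1 + h * (b * M₁ ^ 2 * ensVar u))⁻¹ * (c * ‖g‖ ^ 2)) ≤
      h / 8 * (a ⬝ᵥ (W *ᵥ a)) := by gcongr
  linarith

end Step

/-! ### Scalar recursions -/

section Scalar

open Filter

/-- The sequence `M n^{-p}` is a supersolution of the covariance recursion. -/
theorem upper_recursion {γ p h₀ a M : ℝ} (hγ0 : 0 ≤ γ) (hγ1 : γ < 1) (hp1 : p ≤ 1)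
    (hM : 0 < M) (hM3 : 3 ≤ h₀ * M) (hMa : 4 * a ≤ M) {n : ℕ} (hn : 1 ≤ n) :
    ((M * (n : ℝ) ^ (-p))⁻¹ + h₀ * (n : ℝ) ^ (γ - 1 + p))⁻¹ + a * (n : ℝ) ^ (γ - 1 - p) ≤
      M * ((n + 1 : ℕ) : ℝ) ^ (-p) := by
  have hn1 : (1 : ℝ) ≤ n := by exact_mod_cast hn
  have hn0 : (0 : ℝ) < n := by linarith
  set t := (n : ℝ) ^ (γ - 1) with ht
  set x := (n : ℝ) ^ (-p) with hx
  have hx0 : 0 < x := Real.rpow_pos_of_pos hn0 _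
  have ht0 : 0 < t := Real.rpow_pos_of_pos hn0 _
  have ht1 : t ≤ 1 := Real.rpow_le_one_of_one_le_of_nonpos hn1 (by linarith)
  have htn : (n : ℝ)⁻¹ ≤ t := by
    rw [← Real.rpow_neg_one]
    exact Real.rpow_le_rpow_of_exponent_le hn1 (by linarith)
  have e1 : (n : ℝ) ^ (γ - 1 + p) = t * x⁻¹ := by
    rw [Real.rpow_add hn0, hx, Real.rpow_neg hn0.le, inv_inv]
  have e2 : (n : ℝ) ^ (γ - 1 - p) = t * x := by rw [sub_eq_add_neg, Real.rpow_add hn0]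
  have e3 : ((M * x)⁻¹ + h₀ * (t * x⁻¹))⁻¹ = M * x * (1 + h₀ * M * t)⁻¹ := by
    rw [← inv_inv (M * x * (1 + h₀ * M * t)⁻¹), mul_inv, inv_inv]
    field_simp
  have e4 : x * (1 + t)⁻¹ ≤ ((n + 1 : ℕ) : ℝ) ^ (-p) := by
    have hq : (n : ℝ) / (n + 1) ≤ ((n : ℝ) / (n + 1)) ^ p := by
      have := Real.rpow_le_rpow_of_exponent_ge (x := (n : ℝ) / (n + 1)) (by positivity)
        (by rw [div_le_one (by positivity)]; linarith) hp1
      rwa [Real.rpow_one] at this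
    rw [Real.div_rpow hn0.le (by positivity)] at hq
    have hq2 : (1 + t)⁻¹ ≤ (n : ℝ) / (n + 1) := by
      rw [inv_le_comm₀ (by positivity) (by positivity), inv_div, add_div, div_self hn0.ne',
        one_div]
      linarith
    push_cast
    rw [hx, Real.rpow_neg hn0.le, Real.rpow_neg (by positivity), inv_mul_le_iff₀ (by positivity),
      ← div_eq_mul_inv]
    exact hq2.trans hq
  have e5 : (1 + h₀ * M * t)⁻¹ + 4⁻¹ * t ≤ (1 + t)⁻¹ := by
    have h1 : (1 + h₀ * M * t)⁻¹ ≤ (1 + 3 * t)⁻¹ := by gcongr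
    have h2 : (1 + 3 * t)⁻¹ + 4⁻¹ * t ≤ (1 + t)⁻¹ := by
      rw [← sub_nonneg]
      have : (1 + t)⁻¹ - ((1 + 3 * t)⁻¹ + 4⁻¹ * t) =
          t * (1 - t) * (7 + 3 * t) * (4 * (1 + t) * (1 + 3 * t))⁻¹ := by
        field_simp
        ring
      rw [this]
      have : 0 ≤ 1 - t := by linarith
      positivity
    linarith
  rw [e1, e2, e3]
  calc M * x * (1 + h₀ * M * t)⁻¹ + a * (t * x)
      ≤ M * x * (1 + h₀ * M * t)⁻¹ + 4⁻¹ * M * (t * x) := by gcongr; linarith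
    _ = M * (x * ((1 + h₀ * M * t)⁻¹ + 4⁻¹ * t)) := by ring
    _ ≤ M * (x * (1 + t)⁻¹) := by gcongr
    _ ≤ _ := by gcongr

/-- The sequence `c n^{-p}` is a subsolution of the covariance recursion. -/
theorem lower_recursion {γ p a c k q : ℝ} (hp : 0 ≤ p) (hc : 0 ≤ c) (hca : c * k ≤ a)
    {n : ℕ} (hn : 1 ≤ n) (hq0 : 0 ≤ q) (hq : q ≤ k * (n : ℝ) ^ (γ - 1)) :
    c * ((n + 1 : ℕ) : ℝ) ^ (-p) ≤
      (1 + q)⁻¹ * (c * (n : ℝ) ^ (-p)) + a * (n : ℝ) ^ (γ - 1 - p) := by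
  have hn0 : (0 : ℝ) < n := by exact_mod_cast hn
  have e1 : ((n + 1 : ℕ) : ℝ) ^ (-p) ≤ (n : ℝ) ^ (-p) :=
    Real.rpow_le_rpow_of_nonpos hn0 (by push_cast; linarith) (by linarith)
  have e2 : (n : ℝ) ^ (γ - 1 - p) = (n : ℝ) ^ (γ - 1) * (n : ℝ) ^ (-p) := by
    rw [sub_eq_add_neg, Real.rpow_add hn0]
  have e3 : 1 - q ≤ (1 + q)⁻¹ := by
    rw [← one_div, le_div_iff₀ (by linarith)]
    nlinarith
  rw [e2]
  set t := (n : ℝ) ^ (γ - 1)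
  set x := (n : ℝ) ^ (-p)
  have hx0 : 0 ≤ x := Real.rpow_nonneg hn0.le _
  have ht0 : 0 ≤ t := Real.rpow_nonneg hn0.le _
  calc c * ((n + 1 : ℕ) : ℝ) ^ (-p) ≤ c * x := by gcongr
    _ = (1 - k * t) * (c * x) + c * k * (t * x) := by ring
    _ ≤ (1 + q)⁻¹ * (c * x) + a * (t * x) := by
      gcongr
      linarith

/-- A finite number of exceptions to the descent inequality can be absorbed in the constant. -/
theorem exists_forall_of_eventually {f w : ℕ → ℝ} {B : ℝ} (hw : ∀ n, 1 ≤ n → 0 < w n)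
    (h : ∀ᶠ n in atTop, f n ≤ B * w n) : ∃ B' : ℝ, 0 ≤ B' ∧ ∀ n, 1 ≤ n → f n ≤ B' * w n := by
  obtain ⟨n₀, h₀⟩ := eventually_atTop.1 h
  refine ⟨|B| + ∑ i ∈ Finset.range n₀, |f i / w i|, by positivity, fun n hn => ?_⟩
  have hs : 0 ≤ ∑ i ∈ Finset.range n₀, |f i / w i| := by positivity
  have hwn := hw n hn
  by_cases hnn : n₀ ≤ n
  · refine (h₀ n hnn).trans (mul_le_mul_of_nonneg_right ?_ hwn.le)
    linarith [le_abs_self B]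
  · rw [← div_le_iff₀ hwn]
    have := Finset.single_le_sum (f := fun i => |f i / w i|) (fun i _ => abs_nonneg _)
      (Finset.mem_range.2 (not_le.1 hnn))
    have h3 := le_abs_self (f n / w n)
    have h4 := abs_nonneg B
    linarith

/-- Summation of the descent inequality. The errors `n^{γ-1-p} ≤ N^{γ-θ} n^{-1-(p-θ)}` are summable
up to the factor `N^{γ-θ}`. -/
theorem exists_sum_bound {γ p θ κ B : ℝ} (hθγ : θ ≤ γ) (hθp : θ < p) (hκ : 0 < κ) (hB : 0 ≤ B)
    {g l : ℕ → ℝ} (hl : ∀ n, 0 ≤ l n)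
    (h : ∀ n : ℕ, 1 ≤ n → κ * (n : ℝ) ^ (γ - 1) * g n ^ 2 - (l n - l (n + 1)) ≤
      B * (n : ℝ) ^ (γ - 1 - p)) :
    ∃ Q : ℝ, 0 ≤ Q ∧ ∀ (N : ℕ) (ε : ℝ), 1 ≤ N → 0 ≤ ε →
      (∀ n, 1 ≤ n → n ≤ N → ε ≤ g n) →
      κ * ε ^ 2 * ∑ i ∈ Finset.range N, ((i + 1 : ℕ) : ℝ) ^ (γ - 1) ≤ Q * (N : ℝ) ^ (γ - θ) := by
  have hsum : Summable fun i : ℕ => ((i + 1 : ℕ) : ℝ) ^ (-(1 + (p - θ))) :=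
    (summable_nat_add_iff 1).2 (Real.summable_nat_rpow.2 (by linarith))
  have hpos : ∀ i : ℕ, 0 ≤ ((i + 1 : ℕ) : ℝ) ^ (-(1 + (p - θ))) := fun i => by positivity
  set Z := ∑' i : ℕ, ((i + 1 : ℕ) : ℝ) ^ (-(1 + (p - θ))) with hZ
  have hZ0 : 0 ≤ Z := tsum_nonneg hpos
  refine ⟨l 1 + B * Z, add_nonneg (hl 1) (by positivity), fun N ε hN hε hg => ?_⟩
  have hN1 : (1 : ℝ) ≤ N := by exact_mod_cast hN
  have hNθ : 1 ≤ (N : ℝ) ^ (γ - θ) := Real.one_le_rpow hN1 (by linarith)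
  have h1 : ∀ i ∈ Finset.range N, κ * ε ^ 2 * ((i + 1 : ℕ) : ℝ) ^ (γ - 1) ≤
      (l (i + 1) - l (i + 1 + 1)) +
        B * ((N : ℝ) ^ (γ - θ) * ((i + 1 : ℕ) : ℝ) ^ (-(1 + (p - θ)))) := fun i hi => by
    have hi' : i + 1 ≤ N := Finset.mem_range.1 hi
    have h2 := h (i + 1) (by omega)
    have h3 : ε ^ 2 ≤ g (i + 1) ^ 2 := pow_le_pow_left₀ hε (hg (i + 1) (by omega) hi') 2
    have h4 : ((i + 1 : ℕ) : ℝ) ^ (γ - 1 - p) ≤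
        (N : ℝ) ^ (γ - θ) * ((i + 1 : ℕ) : ℝ) ^ (-(1 + (p - θ))) := by
      have hi0 : (0 : ℝ) < ((i + 1 : ℕ) : ℝ) := by positivity
      have : ((i + 1 : ℕ) : ℝ) ^ (γ - 1 - p) =
          ((i + 1 : ℕ) : ℝ) ^ (γ - θ) * ((i + 1 : ℕ) : ℝ) ^ (-(1 + (p - θ))) := by
        rw [← Real.rpow_add hi0]
        congr 1
        ring
      rw [this]
      gcongr
    have h5 : κ * ε ^ 2 * ((i + 1 : ℕ) : ℝ) ^ (γ - 1) ≤
        κ * ((i + 1 : ℕ) : ℝ) ^ (γ - 1) * g (i + 1) ^ 2 := by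
      rw [mul_right_comm]
      gcongr
    have h6 := mul_le_mul_of_nonneg_left h4 hB
    linarith
  rw [Finset.mul_sum]
  refine (Finset.sum_le_sum h1).trans ?_
  rw [Finset.sum_add_distrib, Finset.sum_range_sub' (fun i => l (i + 1)), ← Finset.mul_sum,
    ← Finset.mul_sum]
  have h7 : ∑ i ∈ Finset.range N, ((i + 1 : ℕ) : ℝ) ^ (-(1 + (p - θ))) ≤ Z :=
    hsum.sum_le_tsum _ fun i _ => hpos i
  calc l (0 + 1) - l (N + 1) + B * ((N : ℝ) ^ (γ - θ) *
        ∑ i ∈ Finset.range N, ((i + 1 : ℕ) : ℝ) ^ (-(1 + (p - θ))))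
      ≤ l 1 * (N : ℝ) ^ (γ - θ) + B * ((N : ℝ) ^ (γ - θ) * Z) := by
        refine add_le_add ?_ (by gcongr)
        have := le_mul_of_one_le_right (hl 1) hNθ
        have := hl (N + 1)
        rw [zero_add]
        linarith
    _ = _ := by ring

/-- A descent inequality with step-sizes `n^{γ-1}` and errors `n^{γ-1-p}`, `p = β + 1 - γ`, yields a
small gradient before the iteration threshold. -/
theorem exists_le_threshold {β γ δ κ B : ℝ} (hγ0 : 0 ≤ γ) (hγ1 : γ < 1) (hδ0 : 0 ≤ δ) (hδ1 : δ < β + 1 - γ)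
    (hκ : 0 < κ) {g l : ℕ → ℝ} (hl : ∀ n, 0 ≤ l n)
    (h : ∀ᶠ n : ℕ in atTop, κ * (n : ℝ) ^ (γ - 1) * g n ^ 2 - (l n - l (n + 1)) ≤
      B * (n : ℝ) ^ (γ - 1 - (β + 1 - γ))) :
    ∃ D : ℝ, 0 < D ∧ ∀ ε : ℝ, 0 < ε →
      ∃ n : ℕ, (n : ℝ) ≤ threshold β γ δ D ε ∧ g n ≤ ε := by
  obtain ⟨B', hB', hd⟩ := exists_forall_of_eventually
    (fun n hn => Real.rpow_pos_of_pos (by exact_mod_cast hn) _) h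
  rcases hγ0.eq_or_lt with rfl | hγ
  · obtain ⟨Q, hQ, hQN⟩ := exists_sum_bound (p := β + 1 - 0) (θ := 0) le_rfl (by linarith) hκ hB' hl hd
    refine ⟨(Q + 1) / κ, by positivity, fun ε hε => ?_⟩
    by_contra! hcon
    rw [threshold, if_pos rfl] at hcon
    set T := Real.exp ((Q + 1) / κ / ε ^ 2) with hT
    have hT1 : 1 ≤ T := Real.one_le_exp (by positivity)
    have h1 := hQN ⌊T⌋₊ ε (Nat.le_floor (by simpa using hT1)) hε.le fun n _ hn =>
      (hcon n ((Nat.cast_le.2 hn).trans (Nat.floor_le (by linarith)))).le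
    have h2 : (Q + 1) / κ / ε ^ 2 ≤
        ∑ i ∈ Finset.range ⌊T⌋₊, ((i + 1 : ℕ) : ℝ) ^ ((0 : ℝ) - 1) := by
      have h3 := log_add_one_le_harmonic ⌊T⌋₊
      have h4 : Real.log T ≤ Real.log (⌊T⌋₊ + 1 : ℕ) :=
        Real.log_le_log (by positivity) (by push_cast; exact (Nat.lt_floor_add_one T).le)
      rw [hT, Real.log_exp, ← hT] at h4
      refine h4.trans (h3.trans (le_of_eq ?_))
      rw [harmonic]
      push_cast
      simp [Real.rpow_neg_one]
    have h5 : κ * ε ^ 2 * ((Q + 1) / κ / ε ^ 2) = Q + 1 := by field_simp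
    have h6 := mul_le_mul_of_nonneg_left h2 (by positivity : 0 ≤ κ * ε ^ 2)
    rw [sub_zero, Real.rpow_zero, mul_one] at h1
    have h7 := h6.trans h1
    rw [h5] at h7
    linarith
  · set θ := min γ ((β + 1 - γ + δ) / 2) with hθ
    have hθ0 : 0 < θ := lt_min hγ (by linarith)
    have hexp : 2 / min (2 * γ) (β + 1 - γ + δ) = θ⁻¹ := by
      have : min (2 * γ) (β + 1 - γ + δ) = 2 * θ := by
        rw [hθ, mul_min_of_nonneg _ _ zero_le_two, mul_div_cancel₀ _ two_ne_zero]
      rw [this]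
      field_simp
    obtain ⟨Q, hQ, hQN⟩ := exists_sum_bound (p := β + 1 - γ) (θ := θ) (min_le_left _ _)
      ((min_le_right _ _).trans_lt (by linarith)) hκ hB' hl hd
    -- the summand `g 0 ^ 2` makes `n = 0` admissible whenever the threshold is below `1`
    refine ⟨2 ^ θ * (Q + 1) / κ + g 0 ^ 2, by positivity, fun ε hε => ?_⟩
    set D := 2 ^ θ * (Q + 1) / κ + g 0 ^ 2 with hD
    have hD0 : 0 < D := by positivity
    by_contra! hcon
    rw [threshold, if_neg hγ.ne', hexp] at hcon
    set T := (D / ε ^ 2) ^ θ⁻¹ with hT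
    have hTθ : T ^ θ = D / ε ^ 2 := Real.rpow_inv_rpow (by positivity) hθ0.ne'
    have hT1 : 1 ≤ T := by
      refine Real.one_le_rpow ?_ (by positivity)
      rw [one_le_div (by positivity)]
      have h0 := hcon 0 (by rw [Nat.cast_zero]; positivity)
      have h00 : ε ^ 2 ≤ g 0 ^ 2 := pow_le_pow_left₀ hε.le h0.le 2
      have : 0 ≤ 2 ^ θ * (Q + 1) / κ := by positivity
      linarith
    have hN : 1 ≤ ⌊T⌋₊ := Nat.le_floor (by simpa using hT1)
    have h1 := hQN ⌊T⌋₊ ε hN hε.le fun n _ hn =>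
      (hcon n ((Nat.cast_le.2 hn).trans (Nat.floor_le (by linarith)))).le
    set N := ⌊T⌋₊ with hNdef
    have hN1 : (1 : ℝ) ≤ N := by exact_mod_cast hN
    have hN0 : (0 : ℝ) < N := by linarith
    have h2 : (N : ℝ) ^ γ ≤ ∑ i ∈ Finset.range N, ((i + 1 : ℕ) : ℝ) ^ (γ - 1) := by
      have hi : ∀ i ∈ Finset.range N, (N : ℝ) ^ (γ - 1) ≤ ((i + 1 : ℕ) : ℝ) ^ (γ - 1) :=
        fun i hi => Real.rpow_le_rpow_of_nonpos (by positivity)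
          (Nat.cast_le.2 (Finset.mem_range.1 hi)) (by linarith)
      have := Finset.card_nsmul_le_sum _ _ _ hi
      rwa [Finset.card_range, nsmul_eq_mul, Real.rpow_sub_one hN0.ne',
        mul_div_cancel₀ _ hN0.ne'] at this
    have h3 : T ^ θ ≤ 2 ^ θ * (N : ℝ) ^ θ := by
      rw [← Real.mul_rpow zero_le_two hN0.le]
      refine Real.rpow_le_rpow (by positivity) ?_ hθ0.le
      have := (Nat.lt_floor_add_one T).le
      linarith
    have h4 : κ * ε ^ 2 * (N : ℝ) ^ θ ≤ Q := by
      have h5 : κ * ε ^ 2 * (N : ℝ) ^ θ * (N : ℝ) ^ (γ - θ) ≤ Q * (N : ℝ) ^ (γ - θ) := by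
        rw [mul_assoc, ← Real.rpow_add hN0, add_sub_cancel]
        exact (mul_le_mul_of_nonneg_left h2 (by positivity)).trans h1
      exact le_of_mul_le_mul_right h5 (Real.rpow_pos_of_pos hN0 _)
    have h6 : κ * D ≤ 2 ^ θ * Q := by
      calc κ * D = κ * ε ^ 2 * T ^ θ := by rw [hTθ]; field_simp
        _ ≤ κ * ε ^ 2 * (2 ^ θ * (N : ℝ) ^ θ) := by gcongr
        _ = 2 ^ θ * (κ * ε ^ 2 * (N : ℝ) ^ θ) := by ring
        _ ≤ _ := by gcongr
    have h7 : κ * D = 2 ^ θ * (Q + 1) + κ * g 0 ^ 2 := by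
      rw [hD, mul_add, mul_div_cancel₀ _ hκ.ne']
    have h8 : 0 < (2 : ℝ) ^ θ := by positivity
    have h9 : 0 ≤ κ * g 0 ^ 2 := by positivity
    linarith

end Scalar

/-! ### Bounds along a run -/

section Run

variable {du dy K : ℕ} {G : Vec du → Vec dy} {y : Vec dy}
  {Γ : Matrix (Fin dy) (Fin dy) ℝ} {S : Matrix (Fin du) (Fin du) ℝ}
  {h₀ α₀ β γ : ℝ} {u : ℕ → Fin K → Vec du}

theorem stepSize_pos (hh₀ : 0 < h₀) (β : ℝ) (n : ℕ) : 0 < stepSize h₀ β n := by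
  unfold stepSize
  split_ifs with hn
  · exact hh₀
  · have : 0 < (n : ℝ) := by exact_mod_cast Nat.pos_of_ne_zero hn
    positivity

/-- The covariances of a run are `O(n^{-(β+1-γ)})`. -/
theorem exists_cov_le (hΓ : Γ.PosDef) (hS : S.PosDef) (hh₀ : 0 < h₀)
    (hγ0 : 0 ≤ γ) (hγ1 : γ < 1) (hβ1 : β ≤ γ)
    (hu : IsRun G y Γ S (stepSize h₀ β) (inflationSq α₀ h₀ β γ) u) :
    ∃ M : ℝ, 0 < M ∧ ∀ n : ℕ, 1 ≤ n → ∀ v, v ⬝ᵥ (ensCov (u n) (u n) *ᵥ v) ≤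
      M * (n : ℝ) ^ (-(β + 1 - γ)) * (v ⬝ᵥ (S *ᵥ v)) := by
  obtain ⟨b, hb0, hb⟩ := exists_dotProduct_mulVec_le (ensCov (u 1) (u 1))
  obtain ⟨s, hs0, hs⟩ := exists_le_dotProduct_mulVec hS
  set M := b / s + 3 / h₀ + 4 * (α₀ ^ 2 * h₀⁻¹) with hM
  have hM0 : 0 < M := by positivity
  have hMb : b / s ≤ M := by
    have : 0 ≤ 3 / h₀ + 4 * (α₀ ^ 2 * h₀⁻¹) := by positivity
    linarith
  have hM3 : 3 ≤ h₀ * M := by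
    have h1 : 0 ≤ b / s + 4 * (α₀ ^ 2 * h₀⁻¹) := by positivity
    have h2 : h₀ * (3 / h₀) ≤ h₀ * M := mul_le_mul_of_nonneg_left (by linarith) hh₀.le
    rwa [mul_div_cancel₀ _ hh₀.ne'] at h2
  have hMa : 4 * (α₀ ^ 2 * h₀⁻¹) ≤ M := by
    have : 0 ≤ b / s + 3 / h₀ := by positivity
    linarith
  refine ⟨M, hM0, fun n hn => ?_⟩
  induction n, hn using Nat.le_induction with
  | base =>
    intro v
    rw [Nat.cast_one, Real.one_rpow, mul_one]
    have h0 : 0 ≤ v ⬝ᵥ (S *ᵥ v) := dotProduct_mulVec_nonneg hS.posSemidef v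
    calc v ⬝ᵥ (ensCov (u 1) (u 1) *ᵥ v) ≤ b * (v ⬝ᵥ v) := hb v
      _ = b / s * (s * (v ⬝ᵥ v)) := by field_simp
      _ ≤ b / s * (v ⬝ᵥ (S *ᵥ v)) := mul_le_mul_of_nonneg_left (hs v) (by positivity)
      _ ≤ M * (v ⬝ᵥ (S *ᵥ v)) := mul_le_mul_of_nonneg_right hMb h0
  | succ n hn ih =>
    intro v
    have hn0 : (0 : ℝ) < n := by exact_mod_cast hn
    have hrec := upper_recursion (p := β + 1 - γ) hγ0 hγ1 (by linarith) hM0 hM3 hMa hn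
    rw [hu.cov_update n]
    refine (cov_update_le hΓ hS (stepSize_pos hh₀ β n) (by positivity) (u n) ih _ v).trans ?_
    refine mul_le_mul_of_nonneg_right (le_trans (le_of_eq ?_) hrec)
      (dotProduct_mulVec_nonneg hS.posSemidef v)
    rw [stepSize, inflationSq, if_neg (by omega), if_neg (by omega)]
    ring_nf

/-- The inflation keeps the covariances of a run above a multiple of `n^{-(β+1-γ)}`. -/
theorem exists_le_cov (hΓ : Γ.PosDef) (hS : S.PosDef) {M b k : ℝ}
    (hM : ∀ a b, ‖augMap G a - augMap G b‖ ≤ M * ‖a - b‖) (hb0 : 0 ≤ b)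
    (hb : ∀ v : Fin dy ⊕ Fin du → ℝ, v ⬝ᵥ ((augCov Γ S)⁻¹ *ᵥ v) ≤ b * (v ⬝ᵥ v))
    (hh₀ : 0 < h₀) (hα₀ : 0 < α₀) (hβ0 : γ - 1 < β)
    (hu : IsRun G y Γ S (stepSize h₀ β) (inflationSq α₀ h₀ β γ) u) (hk : 0 ≤ k)
    (hV : ∀ n : ℕ, 1 ≤ n →
      stepSize h₀ β n * (b * M ^ 2 * ensVar (u n)) ≤ k * (n : ℝ) ^ (γ - 1)) :
    ∃ c : ℝ, 0 < c ∧ ∀ n : ℕ, 1 ≤ n → ∀ v,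
      c * (n : ℝ) ^ (-(β + 1 - γ)) * (v ⬝ᵥ (S *ᵥ v)) ≤ v ⬝ᵥ (ensCov (u n) (u n) *ᵥ v) := by
  set a := α₀ ^ 2 * h₀⁻¹ with ha
  have ha0 : 0 < a := by positivity
  set c := min (α₀ ^ 2) (a / (k + 1)) with hc
  have hc0 : 0 < c := by positivity
  have hca : c * k ≤ a := by
    have h1 : c * (k + 1) ≤ a := (le_div_iff₀ (by positivity)).1 (min_le_right _ _)
    linarith
  refine ⟨c, hc0, fun n hn => ?_⟩
  induction n, hn using Nat.le_induction with
  | base =>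
    intro v
    rw [Nat.cast_one, Real.one_rpow, mul_one]
    have h0 : 0 ≤ v ⬝ᵥ (S *ᵥ v) := dotProduct_mulVec_nonneg hS.posSemidef v
    -- the initial covariance may be singular, but one inflation makes it positive definite
    have h1 := le_cov_update hΓ hS hM hb0 hb (c := 0) (stepSize_pos hh₀ β 0) (u 0)
      (fun v => by
        rw [zero_mul, ensCov_eq, dotProduct_mul_transpose_mulVec, dotProduct_self_eq_norm_sq]
        positivity) (inflationSq α₀ h₀ β γ 0) v
    rw [← hu.cov_update 0, mul_zero, zero_add, inflationSq, if_pos rfl] at h1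
    exact (mul_le_mul_of_nonneg_right (min_le_left _ _) h0).trans h1
  | succ n hn ih =>
    intro v
    have hn0 : (0 : ℝ) < n := by exact_mod_cast hn
    have hVn := ensVar_nonneg (u n)
    have hh := stepSize_pos hh₀ β n
    have hrec := lower_recursion (p := β + 1 - γ) (by linarith) hc0.le hca hn
      (by positivity) (hV n hn)
    rw [hu.cov_update n]
    refine le_trans ?_ (le_cov_update hΓ hS hM hb0 hb hh (u n) ih _ v)
    refine mul_le_mul_of_nonneg_right (hrec.trans (le_of_eq ?_))
      (dotProduct_mulVec_nonneg hS.posSemidef v)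
    rw [inflationSq, if_neg (by omega), ← ha,
      show γ - 1 - (β + 1 - γ) = 2 * γ - β - 2 by ring]

end Run
end EKI

theorem mainTheorem5 {du dy K : ℕ} (G : EKI.Vec du → EKI.Vec dy) (y : EKI.Vec dy)
    (Γ : Matrix (Fin dy) (Fin dy) ℝ) (S : Matrix (Fin du) (Fin du) ℝ)
    (hΓ : Γ.PosDef) (hS : S.PosDef)
    (hG : EKI.HasBoundedDerivs (EKI.augMap G))
    (h₀ α₀ β γ : ℝ) (hh₀ : 0 < h₀) (hα₀ : 0 < α₀)
    (hγ0 : 0 ≤ γ) (hγ1 : γ < 1) (hβ0 : γ - 1 < β) (hβ1 : β ≤ γ)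
    (u : ℕ → Fin K → EKI.Vec du)
    (hu : EKI.IsRun G y Γ S (EKI.stepSize h₀ β) (EKI.inflationSq α₀ h₀ β γ) u)
    (hbdd : ∃ R : ℝ, ∀ n, ‖EKI.ensMean (u n)‖ ≤ R)
    (δ : ℝ) (hδ0 : 0 ≤ δ) (hδ1 : δ < β + 1 - γ) :
    ∃ D : ℝ, 0 < D ∧ ∀ ε : ℝ, 0 < ε →
      ∃ n : ℕ, (n : ℝ) ≤ EKI.threshold β γ δ D ε ∧
        ‖gradient (EKI.loss G y Γ S) (EKI.ensMean (u n))‖ ≤ ε := by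
  obtain ⟨hd1, hd2, M₁, M₂', hM₁', hM₂'⟩ := hG
  obtain ⟨R, hR⟩ := hbdd
  have hM₁ := EKI.norm_sub_le_of_fderiv_le hd1 hM₁'
  have hM₁0 : 0 ≤ M₁ := (norm_nonneg _).trans (hM₁' 0)
  set M₂ := max M₂' 0 with hM₂def
  have hM₂0 : 0 ≤ M₂ := le_max_right _ _
  have hM₂ := EKI.norm_taylor_le hd1 hd2 (M := M₂) fun x v =>
    (hM₂' x v).trans (mul_le_mul_of_nonneg_right (le_max_left _ _) (by positivity))
  obtain ⟨b, hb0, hb⟩ := EKI.exists_dotProduct_mulVec_le (EKI.augCov Γ S)⁻¹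
  obtain ⟨b', hb'0, hb'⟩ := EKI.exists_norm_mulVec_le (EKI.augCov Γ S)⁻¹
  obtain ⟨s, hs0, hs⟩ := EKI.exists_le_dotProduct_mulVec hS
  obtain ⟨M, hM0, hcov⟩ := EKI.exists_cov_le hΓ hS hh₀ hγ0 hγ1 hβ1 hu
  set p := β + 1 - γ with hp
  -- the residuals `H(m_n) - z` are bounded because the means are
  set E := b' * (M₁ * R + ‖EKI.augMap G 0 - EKI.augData du y‖) with hEdef
  have hE : ∀ n, ‖WithLp.toLp 2 ((EKI.augCov Γ S)⁻¹ *ᵥ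
      (EKI.augMap G (EKI.ensMean (u n)) - EKI.augData du y).ofLp)‖ ≤ E := fun n => by
    refine (hb' _).trans (mul_le_mul_of_nonneg_left ?_ hb'0.le)
    rw [← sub_add_sub_cancel _ (EKI.augMap G 0)]
    refine (norm_add_le _ _).trans (add_le_add_left ((hM₁ _ _).trans ?_) _)
    rw [sub_zero]
    exact mul_le_mul_of_nonneg_left (hR n) hM₁0
  have hE0 : 0 ≤ E := (norm_nonneg _).trans (hE 0)
  set T := S.trace with hT
  have hT0 : 0 ≤ T := hS.posSemidef.trace_nonneg
  have hV : ∀ n : ℕ, 1 ≤ n → EKI.ensVar (u n) ≤ M * T * (n : ℝ) ^ (-p) := fun n hn =>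
    (EKI.ensVar_le_of_cov_le (u n) (hcov n hn)).trans (le_of_eq (by ring))
  have hstep : ∀ n : ℕ, 1 ≤ n → EKI.stepSize h₀ β n * (n : ℝ) ^ (-p) =
      h₀ * (n : ℝ) ^ (γ - 1) := fun n hn => by
    rw [EKI.stepSize, if_neg (by omega), mul_assoc, ← Real.rpow_add (by exact_mod_cast hn)]
    congr 2
    rw [hp]
    ring
  have hhV : ∀ n : ℕ, 1 ≤ n →
      EKI.stepSize h₀ β n * EKI.ensVar (u n) ≤ h₀ * (M * T) * (n : ℝ) ^ (γ - 1) := fun n hn => by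
    calc EKI.stepSize h₀ β n * EKI.ensVar (u n)
        ≤ EKI.stepSize h₀ β n * (M * T * (n : ℝ) ^ (-p)) :=
          mul_le_mul_of_nonneg_left (hV n hn) (EKI.stepSize_pos hh₀ β n).le
      _ = M * T * (EKI.stepSize h₀ β n * (n : ℝ) ^ (-p)) := by ring
      _ = _ := by rw [hstep n hn]; ring
  set k := b * M₁ ^ 2 * (h₀ * (M * T)) with hk
  have hk0 : 0 ≤ k := by positivity
  have hhk : ∀ n : ℕ, 1 ≤ n → EKI.stepSize h₀ β n * (b * M₁ ^ 2 * EKI.ensVar (u n)) ≤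
      k * (n : ℝ) ^ (γ - 1) := fun n hn => by
    have := mul_le_mul_of_nonneg_left (hhV n hn) (by positivity : 0 ≤ b * M₁ ^ 2)
    linarith
  obtain ⟨c, hc0, hcov'⟩ := EKI.exists_le_cov hΓ hS hM₁ hb0.le hb hh₀ hα₀ hβ0 hu hk0 hhk
  refine EKI.exists_le_threshold (κ := h₀ * c * s / (8 * (1 + k)))
    (B := 3 / 2 * (M₂ ^ 2 * K * E ^ 2 * (h₀ * (M * T) ^ 2)))
    (l := fun n => EKI.loss G y Γ S (EKI.ensMean (u n))) hγ0 hγ1 hδ0 hδ1 (by positivity)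
    (fun n => EKI.loss_nonneg hΓ hS _) ?_
  -- for large `n` the steps are short enough for the descent estimate, since `γ < 1`
  set L := 4 * (2 * M₂ * E + b * M₁ ^ 2) with hL
  have hsmall : ∀ᶠ n : ℕ in Filter.atTop, L * (h₀ * (M * T) * (n : ℝ) ^ (γ - 1)) ≤ 1 := by
    have h1 : Filter.Tendsto (fun n : ℕ => (n : ℝ) ^ (γ - 1)) Filter.atTop (nhds 0) := by
      have := (tendsto_rpow_neg_atTop (sub_pos.2 hγ1)).comp tendsto_natCast_atTop_atTop
      simpa only [Function.comp_def, neg_sub] using this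
    have h2 := (h1.const_mul (h₀ * (M * T))).const_mul L
    rw [mul_zero, mul_zero] at h2
    exact h2.eventually_le_const one_pos
  filter_upwards [hsmall, Filter.eventually_ge_atTop 1] with n hsm hn
  have hn1 : (1 : ℝ) ≤ n := by exact_mod_cast hn
  have hn0 : (0 : ℝ) < n := by linarith
  have hh := EKI.stepSize_pos hh₀ β n
  have hVn := EKI.ensVar_nonneg (u n)
  have ht0 : 0 < (n : ℝ) ^ (γ - 1) := Real.rpow_pos_of_pos hn0 _
  have ht1 : (n : ℝ) ^ (γ - 1) ≤ 1 := Real.rpow_le_one_of_one_le_of_nonpos hn1 (by linarith)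
  have hx0 : 0 < (n : ℝ) ^ (-p) := Real.rpow_pos_of_pos hn0 _
  have hdesc := EKI.loss_step_le (y := y) hΓ hS hd1 hM₁ hM₂ hM₂0 hb0.le hb hh (u n) (hE n)
    (c := c * (n : ℝ) ^ (-p) * s)
    (fun v => by
      refine le_trans ?_ (hcov' n hn v)
      rw [mul_assoc _ s]
      exact mul_le_mul_of_nonneg_left (hs v) (by positivity))
    ((mul_le_mul_of_nonneg_left (hhV n hn) (by positivity)).trans hsm)
  rw [← hu.mean_update n] at hdesc
  set g := ‖gradient (EKI.loss G y Γ S) (EKI.ensMean (u n))‖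
  have hleft : h₀ * c * s / (8 * (1 + k)) * (n : ℝ) ^ (γ - 1) * g ^ 2 ≤
      EKI.stepSize h₀ β n / 8 * ((1 + EKI.stepSize h₀ β n *
        (b * M₁ ^ 2 * EKI.ensVar (u n)))⁻¹ * (c * (n : ℝ) ^ (-p) * s * g ^ 2)) := by
    have h1 : (1 + k)⁻¹ ≤ (1 + EKI.stepSize h₀ β n * (b * M₁ ^ 2 * EKI.ensVar (u n)))⁻¹ := by
      gcongr
      exact (hhk n hn).trans (mul_le_of_le_one_right hk0 ht1)
    calc h₀ * c * s / (8 * (1 + k)) * (n : ℝ) ^ (γ - 1) * g ^ 2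
        = (h₀ * (n : ℝ) ^ (γ - 1)) * c * s / (8 * (1 + k)) * g ^ 2 := by ring
      _ = EKI.stepSize h₀ β n / 8 * ((1 + k)⁻¹ * (c * (n : ℝ) ^ (-p) * s * g ^ 2)) := by
        rw [← hstep n hn]
        field_simp
      _ ≤ _ := by gcongr
  have hright : 3 / 2 * EKI.stepSize h₀ β n * (M₂ ^ 2 * K * EKI.ensVar (u n) ^ 2 * E ^ 2) ≤
      3 / 2 * (M₂ ^ 2 * K * E ^ 2 * (h₀ * (M * T) ^ 2)) * (n : ℝ) ^ (γ - 1 - p) := by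
    calc 3 / 2 * EKI.stepSize h₀ β n * (M₂ ^ 2 * K * EKI.ensVar (u n) ^ 2 * E ^ 2)
        ≤ 3 / 2 * EKI.stepSize h₀ β n *
          (M₂ ^ 2 * K * (M * T * (n : ℝ) ^ (-p)) ^ 2 * E ^ 2) := by
          gcongr
          exact hV n hn
      _ = 3 / 2 * (M₂ ^ 2 * K * E ^ 2 * ((EKI.stepSize h₀ β n * (n : ℝ) ^ (-p)) *
          (M * T) ^ 2)) * (n : ℝ) ^ (-p) := by ring
      _ = _ := by
          rw [hstep n hn, sub_eq_add_neg _ p, Real.rpow_add hn0]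
          ring
  linarith
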